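/- For every $d\in\mathbb{N}$ there is a constant $C_d<\infty$, depending only on $d$, with the following property. Let $a_1,\dots,a_d\in\mathbb{R}$, let $\alpha_1,\dots,\alpha_d$ be positive integers, and put $Q(t)=a_1t^{\alpha_1}+\dots+a_dt^{\alpha_d}$. Then for every complex-valued $f\in L^2(\mathbb{R})$ the principal value $$H_Qf(x)=\mathrm{p.v.}\int_{\mathbb{R}} f(x-t)\,e^{iQ(t)}\,\frac{dt}{t}=\lim_{\varepsilon\to0^+}\int_{|t|>\varepsilon} f(x-t)\,e^{iQ(t)}\,\frac{dt}{t}$$ exists for almost every $x\in\mathbb{R}$ (the truncated integrals being absolutely convergent), the function $H_Qf$ belongs to $L^2(\mathbb{R})$, and $$\|H_Qf\|_{L^2(\mathbb{R})}\le C_d\,\|f\|_{L^2(\mathbb{R})}.$$ In particular, $C_d$ does not depend on the coefficients $a_i$, on the exponents $\alpha_i$, or on the degree of $Q$. -/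

import Mathlib

open MeasureTheory Filter Topology
open scoped NNReal ENNReal

noncomputable section

/-- The integral of `g` over `{t : ε < |t|}`. -/
def truncatedIntegral (g : ℝ → ℂ) (ε : ℝ) : ℂ :=
  ∫ t in {t : ℝ | ε < |t|}, g t

/-- The principal value at the origin of the integral of `g` over `ℝ` exists and equals `L`:
every truncated integral converges absolutely, and they tend to `L` as `ε → 0+`. -/
def HasPrincipalValue (g : ℝ → ℂ) (L : ℂ) : Prop :=
  (∀ ε : ℝ, 0 < ε → IntegrableOn g {t : ℝ | ε < |t|}) ∧
    Tendsto (truncatedIntegral g) (𝓝[>] 0) (𝓝 L)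

/-- The principal value at the origin of the integral of `g` (meaningful when it exists). -/
def principalValue (g : ℝ → ℂ) : ℂ :=
  limUnder (𝓝[>] (0 : ℝ)) (truncatedIntegral g)

theorem HasPrincipalValue.principalValue_eq {g : ℝ → ℂ} {L : ℂ} (h : HasPrincipalValue g L) :
    principalValue g = L :=
  h.2.limUnder_eq

/-- The phase `Q(t) = a₁ t ^ α₁ + ⋯ + a_d t ^ α_d`. -/
def fewnomial {d : ℕ} (a : Fin d → ℝ) (α : Fin d → ℕ) (t : ℝ) : ℝ :=
  ∑ i, a i * t ^ α i

/-- The integrand `t ↦ f(x - t) e^{iQ(t)} / t`. -/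
def oscIntegrand (Q : ℝ → ℝ) (f : ℝ → ℂ) (x t : ℝ) : ℂ :=
  f (x - t) * Complex.exp (Complex.I * (Q t : ℂ)) / (t : ℂ)

/-- The operator `H_Q f(x) = p.v. ∫ f(x - t) e^{iQ(t)} dt / t`. -/
def oscHilbert (Q : ℝ → ℝ) (f : ℝ → ℂ) (x : ℝ) : ℂ :=
  principalValue (oscIntegrand Q f x)

end

/-!
The constant comes from a bound, in terms of the number `n` of monomials only, for the doubly
truncated integrals `∫ e^{iP(t)} dt / t` over `ε < |t| ≤ R`, where `P` is a real polynomial without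
constant term (`norm_integral_le_phaseBound`). Truncating the kernel `e^{iQ(t)} / t` to
`ε < |t| ≤ R` gives an integrable kernel, whose Fourier integral at `ξ` is an integral of this kind
with `P(t) = Q(t) - 2πξt`, a polynomial with at most `d + 1` monomials. By Plancherel's theorem the
doubly truncated operators are therefore bounded on `L²` with a norm depending on `d` only, and
Fatou's lemma transfers the bound to `H_Q` once the principal value is known to exist.

For the bound, put `u_k(t) = k |b_k| t^k`, the size of the `k`-th term of `t P'(t)`. As long as all
`u_k` are at most `1`, the difference `e^{iP(t)} - e^{iP(-t)}` is `O(∑ |b_k| t^k)`, and its integral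
against `dt / t` is `O(n)`. Afterwards some `u_k` is at least `1`. A quotient `u_k / u_l` is a
monomial of nonzero integral degree, so it is monotone, and it stays between `1 / A` and `A` only on
an interval of logarithmic length at most `2 log A`. Hence `(0, ∞)` is cut into boundedly many
intervals, on each of which either the largest term is comparable to another one, and `∫ dt / t`
itself is bounded, or one term `u_j ≥ 1` is at least `2 n + 2` times each other one. In the latter case an
integration by parts applies (`norm_integral_le_of_dominant`). Its remainder is at most
`4 ∑ u_k' / u_j²`, and the pointwise inequality `u_k' / u_j² ≤ (u_k / u_j² - 2 / u_j)'` bounds the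
remainder by `O(n)` whatever the exponents are.

For the existence of the principal value, `(e^{iQ(t)} - 1) / t` is square-integrable because `Q`
vanishes at the origin, so only the Hilbert transform has to be treated
(`ae_exists_tendsto_hilbert`). Its truncations `T_ε f` converge in `L²` to some `G`: this holds for
Schwartz functions by the smallness of the multipliers of small annuli at fixed frequencies, and in
general by density.
If `τ_δ` is the tent function at scale `δ`, then the kernel of `T_δ - τ_δ * T_ε` is odd and
dominated by the Poisson kernel at scale `δ`, uniformly in `ε ≤ δ`. So `T_δ f - τ_δ * G`
tends to zero at the Lebesgue points of `f`, while `τ_δ * G` tends to `G` at the Lebesgue points of `G`.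
-/

open scoped FourierTransform SchwartzMap Convolution

/-! ### Cutting an interval into monotone regimes -/

open Set in
/-- A set whose trace on `[a, b]` is downward closed cuts `[a, b]` at a single point. -/
lemma exists_cut_of_lower {S : Set ℝ} {a b : ℝ} (hab : a ≤ b)
    (hS : ∀ x y, a ≤ x → x ≤ y → y ≤ b → y ∈ S → x ∈ S) :
    ∃ c ∈ Icc a b, Ioo a c ⊆ S ∧ Ioo c b ⊆ Sᶜ := by
  have hbdd : BddAbove (insert a (S ∩ Icc a b)) :=
    ⟨b, by rintro x (rfl | hx); exacts [hab, hx.2.2]⟩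
  refine ⟨sSup (insert a (S ∩ Icc a b)), ⟨le_csSup hbdd (mem_insert _ _),
    csSup_le (insert_nonempty _ _) (by rintro x (rfl | hx); exacts [hab, hx.2.2])⟩, ?_, ?_⟩
  · rintro x ⟨hax, hx⟩
    obtain ⟨y, rfl | hy, hxy⟩ := exists_lt_of_lt_csSup (insert_nonempty _ _) hx
    · exact absurd hxy hax.not_gt
    · exact hS x y hax.le hxy.le hy.2.2 hy.1
  · rintro x ⟨hx, hxb⟩ hxS
    have hax : a ≤ x := (le_csSup hbdd (mem_insert _ _)).trans hx.le
    exact hx.not_ge (le_csSup hbdd (mem_insert_of_mem _ ⟨hxS, hax, hxb.le⟩))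

open Set in
/-- A set whose trace on `[a, b]` is downward or upward closed cuts `[a, b]` at a single point
into two intervals on each of which membership in the set is constant. -/
lemma exists_cut_of_monotone {S : Set ℝ} {a b : ℝ} (hab : a ≤ b)
    (hS : (∀ x y, a ≤ x → x ≤ y → y ≤ b → y ∈ S → x ∈ S) ∨
      (∀ x y, a ≤ x → x ≤ y → y ≤ b → x ∈ S → y ∈ S)) :
    ∃ c ∈ Icc a b, (Ioo a c ⊆ S ∨ Ioo a c ⊆ Sᶜ) ∧ (Ioo c b ⊆ S ∨ Ioo c b ⊆ Sᶜ) := by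
  rcases hS with hS | hS
  · obtain ⟨c, hc, h1, h2⟩ := exists_cut_of_lower hab hS
    exact ⟨c, hc, .inl h1, .inr h2⟩
  · obtain ⟨c, hc, h1, h2⟩ := exists_cut_of_lower (S := Sᶜ) hab
      (fun x y hx hxy hy hyS hxS => hyS (hS x y hx hxy hy hxS))
    exact ⟨c, hc, .inr h1, .inl (by simpa using h2)⟩

open Set in
/-- If finitely many sets, each downward or upward closed in `[a, b]`, are given, and an integral is
at most `C` over every subinterval on which membership in each of the sets is constant, then
the integral over `[a, b]` is at most `2 ^ N * C`, where `N` is the number of sets. -/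
lemma norm_intervalIntegral_le_of_cuts {ι : Type*} {g : ℝ → ℂ} {C : ℝ} (s : Finset ι)
    (S : ι → Set ℝ) {a b : ℝ} (hab : a ≤ b) (hg : ContinuousOn g (Icc a b))
    (hS : ∀ i ∈ s, (∀ x y, a ≤ x → x ≤ y → y ≤ b → y ∈ S i → x ∈ S i) ∨
      (∀ x y, a ≤ x → x ≤ y → y ≤ b → x ∈ S i → y ∈ S i))
    (h : ∀ p q, a ≤ p → p ≤ q → q ≤ b →
      (∀ i ∈ s, Ioo p q ⊆ S i ∨ Ioo p q ⊆ (S i)ᶜ) → ‖∫ t in p..q, g t‖ ≤ C) :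
    ‖∫ t in a..b, g t‖ ≤ 2 ^ s.card * C := by
  classical
  induction s using Finset.induction_on generalizing a b with
  | empty => simpa using h a b le_rfl hab le_rfl (by simp)
  | insert i s his ih =>
    obtain ⟨c, hc, h1, h2⟩ := exists_cut_of_monotone hab (hS i (Finset.mem_insert_self _ _))
    have hL := ih hc.1 (hg.mono (Icc_subset_Icc le_rfl hc.2))
      (fun k hk => (hS k (Finset.mem_insert_of_mem hk)).imp
        (fun H x y hx hxy hy => H x y hx hxy (hy.trans hc.2))
        (fun H x y hx hxy hy => H x y hx hxy (hy.trans hc.2)))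
      (fun p q hp hpq hq H => h p q hp hpq (hq.trans hc.2) (by
        intro k hk
        rcases Finset.mem_insert.1 hk with rfl | hk
        · exact h1.imp (Ioo_subset_Ioo hp hq).trans (Ioo_subset_Ioo hp hq).trans
        · exact H k hk))
    have hR := ih hc.2 (hg.mono (Icc_subset_Icc hc.1 le_rfl))
      (fun k hk => (hS k (Finset.mem_insert_of_mem hk)).imp
        (fun H x y hx hxy hy => H x y (hc.1.trans hx) hxy hy)
        (fun H x y hx hxy hy => H x y (hc.1.trans hx) hxy hy))
      (fun p q hp hpq hq H => h p q (hc.1.trans hp) hpq hq (by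
        intro k hk
        rcases Finset.mem_insert.1 hk with rfl | hk
        · exact h2.imp (Ioo_subset_Ioo hp hq).trans (Ioo_subset_Ioo hp hq).trans
        · exact H k hk))
    have hi1 : IntervalIntegrable g volume a c :=
      (hg.mono (Icc_subset_Icc le_rfl hc.2)).intervalIntegrable_of_Icc hc.1
    have hi2 : IntervalIntegrable g volume c b :=
      (hg.mono (Icc_subset_Icc hc.1 le_rfl)).intervalIntegrable_of_Icc hc.2
    rw [← intervalIntegral.integral_add_adjacent_intervals hi1 hi2,
      Finset.card_insert_of_notMem his]
    calc _ ≤ _ := norm_add_le _ _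
      _ ≤ 2 ^ s.card * C + 2 ^ s.card * C := add_le_add hL hR
      _ = _ := by ring

/-- If `k ≤ l`, then `e t ^ l ≤ c t ^ k` is a downward closed condition on `t > 0`. -/
lemma mul_pow_le_mul_pow_of_le {c e x y : ℝ} {k l : ℕ} (hkl : k ≤ l) (he : 0 ≤ e) (hx : 0 < x)
    (hxy : x ≤ y) (h : e * y ^ l ≤ c * y ^ k) : e * x ^ l ≤ c * x ^ k := by
  have hy : 0 < y := hx.trans_le hxy
  obtain ⟨m, rfl⟩ := Nat.exists_eq_add_of_le hkl
  have h1 : e * y ^ m ≤ c := by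
    have : (e * y ^ m) * y ^ k ≤ c * y ^ k := by rw [pow_add] at h; linarith
    exact le_of_mul_le_mul_right this (by positivity)
  calc e * x ^ (k + m) = (e * x ^ m) * x ^ k := by ring
    _ ≤ (e * y ^ m) * x ^ k := by gcongr
    _ ≤ c * x ^ k := by gcongr

/-- If `k ≤ l`, then `c t ^ k ≤ e t ^ l` is an upward closed condition on `t > 0`. -/
lemma mul_pow_le_mul_pow_of_ge {c e x y : ℝ} {k l : ℕ} (hkl : k ≤ l) (he : 0 ≤ e) (hx : 0 < x)
    (hxy : x ≤ y) (h : c * x ^ k ≤ e * x ^ l) : c * y ^ k ≤ e * y ^ l := by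
  have hy : 0 < y := hx.trans_le hxy
  obtain ⟨m, rfl⟩ := Nat.exists_eq_add_of_le hkl
  have h1 : c ≤ e * x ^ m := by
    have : c * x ^ k ≤ (e * x ^ m) * x ^ k := by rw [pow_add] at h; linarith
    exact le_of_mul_le_mul_right this (by positivity)
  calc c * y ^ k ≤ (e * x ^ m) * y ^ k := by gcongr
    _ ≤ (e * y ^ m) * y ^ k := by gcongr
    _ = e * y ^ (k + m) := by ring

/-- Two monomials of distinct degrees are comparable up to the factor `A` only on an interval
of bounded logarithmic length. -/
lemma le_sq_mul_of_comparable {c e A x y : ℝ} {k l : ℕ} (hkl : k < l) (he : 0 < e)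
    (hA : 0 < A) (hx : 0 < x) (hxy : x ≤ y)
    (h1 : c * x ^ k ≤ A * (e * x ^ l)) (h2 : e * y ^ l ≤ A * (c * y ^ k)) : y ≤ A ^ 2 * x := by
  have hy : 0 < y := hx.trans_le hxy
  obtain ⟨m, rfl⟩ := Nat.exists_eq_add_of_lt hkl
  have h1' : c ≤ A * e * x ^ (m + 1) := by
    have : c * x ^ k ≤ (A * e * x ^ (m + 1)) * x ^ k := by
      rw [show k + m + 1 = k + (m + 1) by ring, pow_add] at h1; linarith
    exact le_of_mul_le_mul_right this (by positivity)
  have h2' : e * y ^ (m + 1) ≤ A * c := by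
    have : (e * y ^ (m + 1)) * y ^ k ≤ (A * c) * y ^ k := by
      rw [show k + m + 1 = k + (m + 1) by ring, pow_add] at h2; linarith
    exact le_of_mul_le_mul_right this (by positivity)
  have h3 : e * y ^ (m + 1) ≤ e * (A ^ 2 * x ^ (m + 1)) := by
    calc _ ≤ A * c := h2'
      _ ≤ A * (A * e * x ^ (m + 1)) := by gcongr
      _ = _ := by ring
  have h4 : y ^ m * y ≤ y ^ m * (A ^ 2 * x) := by
    calc y ^ m * y = y ^ (m + 1) := (pow_succ _ _).symm
      _ ≤ A ^ 2 * x ^ (m + 1) := le_of_mul_le_mul_left h3 he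
      _ = x ^ m * (A ^ 2 * x) := by ring
      _ ≤ y ^ m * (A ^ 2 * x) := by gcongr
  exact le_of_mul_le_mul_left h4 (by positivity)

/-! ### The first derivative test for a dominant monomial -/

/-- The polynomial `t ↦ ∑ k ∈ s, b k t ^ k` whose monomials have exponents in `s`. -/
def monomialSum (s : Finset ℕ) (b : ℕ → ℝ) (t : ℝ) : ℝ :=
  ∑ k ∈ s, b k * t ^ k

@[fun_prop]
lemma continuous_monomialSum (s : Finset ℕ) (b : ℕ → ℝ) : Continuous (monomialSum s b) := by
  unfold monomialSum; fun_prop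

/-- The derivative of `∑ b k t ^ k`, written so that `t` times it is again of this form. -/
lemma hasDerivAt_monomialSum (s : Finset ℕ) (b : ℕ → ℝ) {t : ℝ} (ht : t ≠ 0) :
    HasDerivAt (monomialSum s b) (monomialSum s (fun k => k * b k) t / t) t := by
  unfold monomialSum
  rw [Finset.sum_div]
  refine HasDerivAt.fun_sum fun k _ => ?_
  convert! (hasDerivAt_pow k t).const_mul (b k) using 1
  rcases k with _ | k
  · simp
  · field_simp
    simp [pow_succ]
    ring

lemma hasDerivAt_const_mul_pow (c : ℝ) (k : ℕ) {t : ℝ} (ht : t ≠ 0) :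
    HasDerivAt (fun t => c * t ^ k) (k * (c * t ^ k) / t) t := by
  convert! (hasDerivAt_pow k t).const_mul c using 1
  rcases k with _ | k
  · simp
  · field_simp
    simp [pow_succ]
    ring

/-- The size `k |b k| t ^ k` of the `k`-th term of `t P'(t)`, for `P = ∑ b k t ^ k`. -/
def termSize (b : ℕ → ℝ) (k : ℕ) (t : ℝ) : ℝ :=
  (k * |b k|) * t ^ k

@[fun_prop]
lemma continuous_termSize (b : ℕ → ℝ) (k : ℕ) : Continuous (termSize b k) := by
  unfold termSize; fun_prop

lemma termSize_nonneg (b : ℕ → ℝ) (k : ℕ) {t : ℝ} (ht : 0 ≤ t) : 0 ≤ termSize b k t := by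
  unfold termSize; positivity

/-- The terms of `t P'(t)` other than the `j`-th one are bounded by their sizes. -/
lemma abs_monomialSum_sub_le (s : Finset ℕ) (b : ℕ → ℝ) {j : ℕ} (hj : j ∈ s) {t : ℝ}
    (ht : 0 ≤ t) :
    |monomialSum s (fun k => k * b k) t - j * b j * t ^ j| ≤ ∑ k ∈ s.erase j, termSize b k t := by
  unfold monomialSum
  rw [← Finset.add_sum_erase s _ hj, add_sub_cancel_left]
  refine (Finset.abs_sum_le_sum_abs _ _).trans (Finset.sum_le_sum fun k _ => ?_)
  rw [abs_mul, abs_mul, abs_pow, abs_of_nonneg ht, Nat.abs_cast, termSize]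

/-- The first derivative test. On an interval on which the term of order `j` of `t P'(t)` is at
least `1` and dominates the other terms, the integral of `e^{iP(t)} / t` is bounded in terms of the
number of monomials only. -/
lemma norm_integral_le_of_dominant {s : Finset ℕ} {b : ℕ → ℝ} {j : ℕ} (hj : j ∈ s) {p q : ℝ}
    (hp : 0 < p) (hpq : p ≤ q) (h1 : ∀ t ∈ Set.Icc p q, 1 ≤ termSize b j t)
    (hdom : ∀ t ∈ Set.Icc p q, ∀ i ∈ s, i ≠ j →
      (2 * s.card + 2) * termSize b i t ≤ termSize b j t) :
    ‖∫ t in p..q, Complex.exp (Complex.I * (monomialSum s b t : ℂ)) / (t : ℂ)‖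
      ≤ 4 + 12 * s.card := by
  set P := monomialSum s b with hP
  set v := monomialSum s (fun k => k * b k) with hv
  set w := monomialSum s (fun k => k * (k * b k)) with hw
  set u := termSize b with hu
  have hpos : ∀ t ∈ Set.Icc p q, 0 < t := fun t ht => hp.trans_le ht.1
  have hle : ∀ t ∈ Set.Icc p q, ∀ i ∈ s, u i t ≤ u j t := by
    intro t ht i hi
    by_cases hij : i = j
    · rw [hij]
    · have h2 := hdom t ht i hi hij
      have h3 := termSize_nonneg b i (hpos t ht).le
      have h4 : (0 : ℝ) ≤ s.card := Nat.cast_nonneg _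
      nlinarith
  -- the dominant term controls the derivative of the phase from below
  have hlow : ∀ t ∈ Set.Icc p q, u j t / 2 ≤ |v t| := by
    intro t ht
    have h2 := abs_monomialSum_sub_le s b hj (hpos t ht).le
    have h3 : ∑ k ∈ s.erase j, u k t ≤ u j t / 2 := by
      have : ∀ k ∈ s.erase j, u k t ≤ u j t / (2 * s.card + 2) := fun k hk => by
        rw [le_div_iff₀ (by positivity), mul_comm]
        exact hdom t ht k (Finset.mem_of_mem_erase hk) (Finset.ne_of_mem_erase hk)
      refine (Finset.sum_le_card_nsmul _ _ _ this).trans ?_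
      rw [nsmul_eq_mul]
      have hc : ((s.erase j).card : ℝ) ≤ s.card := by
        exact_mod_cast Finset.card_erase_le
      have h5 := termSize_nonneg b j (hpos t ht).le
      rw [mul_div_assoc', div_le_div_iff₀ (by positivity) (by norm_num)]
      change _ * u j t * 2 ≤ u j t * _
      nlinarith
    have h4 : |(j : ℝ) * b j * t ^ j| = u j t := by
      rw [abs_mul, abs_mul, abs_pow, abs_of_nonneg (hpos t ht).le, Nat.abs_cast]; rfl
    have h5 := abs_sub_abs_le_abs_sub ((j : ℝ) * b j * t ^ j) (v t)
    rw [abs_sub_comm, h4] at h5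
    linarith
  have hv0 : ∀ t ∈ Set.Icc p q, v t ≠ 0 := fun t ht h => by
    have := hlow t ht; have := h1 t ht
    rw [h, abs_zero] at *; change 1 ≤ u j t at this; linarith
  have hu0 : ∀ t ∈ Set.Icc p q, u j t ≠ 0 := fun t ht h => by
    have := h1 t ht; change 1 ≤ u j t at this; linarith
  have hvc : Continuous v := continuous_monomialSum _ _
  have hwc : Continuous w := continuous_monomialSum _ _
  have hPc : Continuous P := continuous_monomialSum _ _
  have huc : ∀ i, Continuous (u i) := continuous_termSize b
  -- integration by parts: `G = F' + E`, with boundary term `F` and remainder `E`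
  let F : ℝ → ℂ := fun t => Complex.exp (Complex.I * (P t : ℂ)) / (Complex.I * (v t : ℂ))
  let E : ℝ → ℂ := fun t => Complex.exp (Complex.I * (P t : ℂ)) * ((w t / t : ℝ) : ℂ) /
    (Complex.I * (v t : ℂ) ^ 2)
  let G : ℝ → ℂ := fun t => Complex.exp (Complex.I * (P t : ℂ)) / (t : ℂ)
  have hF : ∀ t ∈ Set.uIcc p q, HasDerivAt F (G t - E t) t := by
    intro t ht
    rw [Set.uIcc_of_le hpq] at ht
    have ht0 := (hpos t ht).ne'
    have hvt : (v t : ℂ) ≠ 0 := by exact_mod_cast hv0 t ht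
    have htc : (t : ℂ) ≠ 0 := by exact_mod_cast ht0
    have d1 : HasDerivAt (fun t => Complex.exp (Complex.I * (P t : ℂ)))
        (Complex.exp (Complex.I * (P t : ℂ)) * (Complex.I * ((v t / t : ℝ) : ℂ))) t :=
      (((hasDerivAt_monomialSum s b ht0).ofReal_comp).const_mul Complex.I).cexp
    have d2 : HasDerivAt (fun t => Complex.I * (v t : ℂ)) (Complex.I * ((w t / t : ℝ) : ℂ)) t :=
      ((hasDerivAt_monomialSum s (fun k => k * b k) ht0).ofReal_comp).const_mul Complex.I
    convert! d1.div d2 (mul_ne_zero Complex.I_ne_zero hvt) using 1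
    simp only [G, E]
    push_cast
    field_simp
  have hEc : ContinuousOn E (Set.Icc p q) := by
    refine ContinuousOn.div ?_ ?_ ?_
    · refine ContinuousOn.mul (by fun_prop) ?_
      refine Complex.continuous_ofReal.comp_continuousOn ?_
      exact hwc.continuousOn.div continuousOn_id fun t ht => (hpos t ht).ne'
    · fun_prop
    · intro t ht
      have : (v t : ℂ) ≠ 0 := by exact_mod_cast hv0 t ht
      simp [this]
  have hGc : ContinuousOn G (Set.Icc p q) := by
    refine ContinuousOn.div (by fun_prop) (by fun_prop) fun t ht => ?_
    exact_mod_cast (hpos t ht).ne'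
  have hEi : IntervalIntegrable E volume p q := hEc.intervalIntegrable_of_Icc hpq
  have hGi : IntervalIntegrable G volume p q := hGc.intervalIntegrable_of_Icc hpq
  -- `B i` is an antiderivative of a majorant of the `i`-th term of the remainder `E`
  let B : ℕ → ℝ → ℝ := fun i t => u i t / u j t ^ 2 - 2 / u j t
  let B' : ℕ → ℝ → ℝ := fun i t =>
    (i * u i t / t * u j t ^ 2 - u i t * (2 * u j t * (j * u j t / t))) / (u j t ^ 2) ^ 2
      + 2 * (j * u j t / t) / u j t ^ 2
  have hB : ∀ i, ∀ t ∈ Set.uIcc p q, HasDerivAt (B i) (B' i t) t := by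
    intro i t ht
    rw [Set.uIcc_of_le hpq] at ht
    have ht0 := (hpos t ht).ne'
    have di : HasDerivAt (u i) (i * u i t / t) t := hasDerivAt_const_mul_pow _ _ ht0
    have dj : HasDerivAt (u j) (j * u j t / t) t := hasDerivAt_const_mul_pow _ _ ht0
    have d2 : HasDerivAt (fun t => u j t ^ 2) (2 * u j t * (j * u j t / t)) t := by
      simpa using dj.fun_pow 2
    have d3 := (hasDerivAt_const t (2 : ℝ)).div dj (hu0 t ht)
    convert! (di.div d2 (pow_ne_zero 2 (hu0 t ht))).sub d3 using 1
    simp only [B']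
    ring
  have hBc : ∀ i, ContinuousOn (B' i) (Set.Icc p q) := by
    intro i
    have hid : ∀ c k, ContinuousOn (fun t => c * u k t / t) (Set.Icc p q) := fun c k =>
      ContinuousOn.div (by fun_prop) continuousOn_id fun t ht => (hpos t ht).ne'
    have := hid i i
    have := hid j j
    refine ContinuousOn.add (ContinuousOn.div (by fun_prop) (by fun_prop) ?_)
      (ContinuousOn.div (by fun_prop) (by fun_prop) ?_)
    · exact fun t ht => pow_ne_zero 2 (pow_ne_zero 2 (hu0 t ht))
    · exact fun t ht => pow_ne_zero 2 (hu0 t ht)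
  have hBi : ∀ i, IntervalIntegrable (B' i) volume p q := fun i =>
    (hBc i).intervalIntegrable_of_Icc hpq
  -- the difference of the two sides is `2 j (u j - u i) / (t u j ^ 2)`, so that no relation
  -- between the exponents `i` and `j` is needed
  have hterm : ∀ t ∈ Set.Icc p q, ∀ i ∈ s, (i * u i t) / t / u j t ^ 2 ≤ B' i t := by
    intro t ht i hi
    have h0 := hpos t ht
    have h2 := hu0 t ht
    have h3 : B' i t - (i * u i t) / t / u j t ^ 2 = 2 * j * (u j t - u i t) / (t * u j t ^ 2) := by
      simp only [B']; field_simp; ring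
    have h4 : 0 ≤ 2 * j * (u j t - u i t) / (t * u j t ^ 2) := by
      have := hle t ht i hi
      have : 0 ≤ u j t - u i t := by linarith
      positivity
    linarith
  have hEB : ∀ t ∈ Set.Icc p q, ‖E t‖ ≤ 4 * ∑ i ∈ s, B' i t := by
    intro t ht
    have h0 := hpos t ht
    have hE : ‖E t‖ = |w t| / t / |v t| ^ 2 := by
      simp only [E]
      rw [norm_div, norm_mul, norm_mul, Complex.norm_exp_I_mul_ofReal, norm_pow, Complex.norm_I,
        Complex.norm_real,
        Complex.norm_real, Real.norm_eq_abs, Real.norm_eq_abs, abs_div, abs_of_pos h0]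
      ring
    have hwb : |w t| ≤ ∑ i ∈ s, i * u i t := by
      simp only [hw, monomialSum]
      refine (Finset.abs_sum_le_sum_abs _ _).trans (Finset.sum_le_sum fun k _ => le_of_eq ?_)
      rw [abs_mul, abs_mul, abs_mul, abs_pow, abs_of_pos h0, Nat.abs_cast]
      simp only [hu, termSize]; ring
    have huj : 0 < u j t := lt_of_lt_of_le one_pos (h1 t ht)
    calc ‖E t‖ = |w t| / t / |v t| ^ 2 := hE
      _ ≤ (∑ i ∈ s, i * u i t) / t / (u j t / 2) ^ 2 := by
          have := hlow t ht
          gcongr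
          exact div_nonneg (Finset.sum_nonneg fun i _ =>
            mul_nonneg (Nat.cast_nonneg _) (termSize_nonneg b i h0.le)) h0.le
      _ = 4 * ∑ i ∈ s, (i * u i t) / t / u j t ^ 2 := by
          rw [← Finset.sum_div, ← Finset.sum_div]; field_simp; ring
      _ ≤ _ := by
          gcongr with i hi
          exact hterm t ht i hi
  have hEint : ‖∫ t in p..q, E t‖ ≤ 12 * s.card := by
    have hsum : IntervalIntegrable (fun t => 4 * ∑ i ∈ s, B' i t) volume p q := by
      refine IntervalIntegrable.const_mul ?_ _
      simpa only [Finset.sum_fn] using IntervalIntegrable.sum s fun i _ => hBi i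
    refine (intervalIntegral.norm_integral_le_of_norm_le hpq
      (Filter.Eventually.of_forall fun t ht => hEB t ⟨ht.1.le, ht.2⟩) hsum).trans ?_
    rw [intervalIntegral.integral_const_mul, intervalIntegral.integral_finsetSum fun i _ => hBi i,
      Finset.sum_congr rfl fun i _ => intervalIntegral.integral_eq_sub_of_hasDerivAt (hB i) (hBi i)]
    have hBd : ∀ i ∈ s, B i q - B i p ≤ 3 := by
      intro i hi
      have hq : q ∈ Set.Icc p q := ⟨hpq, le_rfl⟩
      have hp' : p ∈ Set.Icc p q := ⟨le_rfl, hpq⟩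
      have e1 : u i q / u j q ^ 2 ≤ 1 := by
        have a1 : 1 ≤ u j q := h1 q hq
        have a2 := hle q hq i hi
        rw [div_le_one (by positivity)]
        nlinarith
      have e2 : 0 ≤ 2 / u j q := by
        have a1 : 1 ≤ u j q := h1 q hq
        positivity
      have e3 : 0 ≤ u i p / u j p ^ 2 :=
        div_nonneg (termSize_nonneg b i hp.le) (by positivity)
      have e4 : 2 / u j p ≤ 2 := by
        have a1 : 1 ≤ u j p := h1 p hp'
        rw [div_le_iff₀ (by linarith)]; linarith
      simp only [B]; linarith
    have := Finset.sum_le_card_nsmul _ _ _ hBd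
    rw [nsmul_eq_mul] at this
    linarith
  have hFle : ∀ t ∈ Set.Icc p q, ‖F t‖ ≤ 2 := by
    intro t ht
    have h2 := hlow t ht
    have h3 : 1 ≤ u j t := h1 t ht
    simp only [F]
    rw [norm_div, norm_mul, Complex.norm_exp_I_mul_ofReal, Complex.norm_I, Complex.norm_real,
      Real.norm_eq_abs, one_mul,
      div_le_iff₀ (by linarith)]
    linarith
  have hsplit : ∫ t in p..q, G t = (F q - F p) + ∫ t in p..q, E t := by
    rw [← intervalIntegral.integral_eq_sub_of_hasDerivAt hF (hGi.sub hEi),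
      intervalIntegral.integral_sub hGi hEi]
    ring
  change ‖∫ t in p..q, G t‖ ≤ _
  rw [hsplit]
  have n1 := norm_add_le (F q - F p) (∫ t in p..q, E t)
  have n2 := norm_sub_le (F q) (F p)
  have n3 := hFle q ⟨hpq, le_rfl⟩
  have n4 := hFle p ⟨le_rfl, hpq⟩
  linarith

/-! ### The uniform bound for truncated oscillatory integrals -/

/-- An interval of bounded logarithmic length contributes a bounded amount. -/
lemma norm_integral_le_of_le_mul {P : ℝ → ℝ} {p q A : ℝ} (hp : 0 < p) (hpq : p ≤ q)
    (hq : q ≤ A * p) :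
    ‖∫ t in p..q, Complex.exp (Complex.I * (P t : ℂ)) / (t : ℂ)‖ ≤ A := by
  have hi : IntervalIntegrable (fun t : ℝ => p⁻¹) volume p q := intervalIntegrable_const
  refine (intervalIntegral.norm_integral_le_of_norm_le hpq
    (Filter.Eventually.of_forall fun t ht => ?_) hi).trans ?_
  · have : 0 < t := hp.trans ht.1
    rw [norm_div, Complex.norm_exp_I_mul_ofReal, Complex.norm_real, Real.norm_eq_abs,
      abs_of_pos this, one_div]
    exact inv_anti₀ hp ht.1.le
  · rw [intervalIntegral.integral_const, smul_eq_mul, ← div_eq_mul_inv, div_le_iff₀ hp]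
    linarith

open Set in
/-- The case of an interval on which each pair of terms is in a fixed regime, the larger one being
either always or never at least `2 n + 2` times the smaller one. Either one term dominates all the
others, or two of them are comparable and the interval is short. -/
lemma norm_integral_le_of_regimes {s : Finset ℕ} {b : ℕ → ℝ} {p q : ℝ} (hp : 0 < p) (hpq : p ≤ q)
    (hlarge : ∀ t ∈ Ioo p q, ∃ k ∈ s, 1 ≤ termSize b k t)
    (hreg : ∀ i ∈ s, ∀ j ∈ s,
      Ioo p q ⊆ {t | (2 * s.card + 2) * termSize b j t ≤ termSize b i t} ∨
      Ioo p q ⊆ {t | (2 * s.card + 2) * termSize b j t ≤ termSize b i t}ᶜ) :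
    ‖∫ t in p..q, Complex.exp (Complex.I * (monomialSum s b t : ℂ)) / (t : ℂ)‖
      ≤ 4 + 12 * s.card + (2 * s.card + 2) ^ 2 := by
  set A : ℝ := 2 * s.card + 2 with hA
  have hA2 : 2 ≤ A := by have : (0 : ℝ) ≤ s.card := Nat.cast_nonneg _; linarith
  have hA0 : (0 : ℝ) ≤ 4 + 12 * s.card := by positivity
  rcases hpq.eq_or_lt with rfl | hlt
  · simp; positivity
  obtain ⟨t₀, ht₀⟩ : (Ioo p q).Nonempty := nonempty_Ioo.2 hlt
  obtain ⟨k, hk, hk1⟩ := hlarge t₀ ht₀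
  obtain ⟨j, hj, hjmax⟩ := s.exists_max_image (fun k => termSize b k t₀) ⟨k, hk⟩
  have hj1 : 1 ≤ termSize b j t₀ := hk1.trans (hjmax k hk)
  have hpos : ∀ t ∈ Ioo p q, 0 < t := fun t ht => hp.trans ht.1
  by_cases hdom : ∀ i ∈ s, i ≠ j → Ioo p q ⊆ {t | A * termSize b i t ≤ termSize b j t}
  · -- the hypotheses extend to the endpoints by continuity
    have hIcc : ∀ {S : Set ℝ}, IsClosed S → Ioo p q ⊆ S → Icc p q ⊆ S := fun hS h => by
      rw [← closure_Ioo hlt.ne]; exact hS.closure_subset_iff.2 h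
    have h1 : Icc p q ⊆ {t | 1 ≤ termSize b j t} := by
      refine hIcc (isClosed_le (by fun_prop) (by fun_prop)) fun t ht => ?_
      obtain ⟨i, hi, hi1⟩ := hlarge t ht
      by_cases hij : i = j
      · exact hij ▸ hi1
      · have h2 : A * termSize b i t ≤ termSize b j t := hdom i hi hij ht
        change 1 ≤ termSize b j t
        nlinarith
    refine (norm_integral_le_of_dominant hj hp hpq h1 fun t ht i hi hij => ?_).trans ?_
    · exact hIcc (S := {t | A * termSize b i t ≤ termSize b j t})
        (isClosed_le (by fun_prop) (by fun_prop)) (hdom i hi hij) ht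
    · have : 0 ≤ A ^ 2 := by positivity
      linarith
  · push Not at hdom
    obtain ⟨i, hi, hij, hnot⟩ := hdom
    have h1 : ∀ t ∈ Ioo p q, termSize b j t < A * termSize b i t := fun t ht =>
      not_le.1 ((hreg j hj i hi).resolve_left hnot ht)
    have h2 : ∀ t ∈ Ioo p q, termSize b i t < A * termSize b j t := by
      refine fun t ht => not_le.1 ((hreg i hi j hj).resolve_left (fun h => ?_) ht)
      have h3 : A * termSize b j t₀ ≤ termSize b i t₀ := h ht₀
      have h4 : termSize b i t₀ ≤ termSize b j t₀ := hjmax i hi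
      nlinarith
    have hsize : ∀ {k}, 0 < termSize b k t₀ → 0 < (k * |b k|) := fun h => by
      refine pos_of_mul_pos_left h (pow_nonneg (hpos t₀ ht₀).le _)
    have hcj := hsize (k := j) (by linarith)
    have hci := hsize (k := i) (by have := h1 t₀ ht₀; by_contra! h; nlinarith)
    have hratio : ∀ x ∈ Ioo p q, ∀ y ∈ Ioo p q, x ≤ y → y ≤ A ^ 2 * x := by
      intro x hx y hy hxy
      rcases lt_or_gt_of_ne hij with h | h
      · exact le_sq_mul_of_comparable h hcj (by linarith) (hpos x hx) hxy (h2 x hx).le (h1 y hy).le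
      · exact le_sq_mul_of_comparable h hci (by linarith) (hpos x hx) hxy (h1 x hx).le (h2 y hy).le
    -- the comparison inside the open interval passes to the endpoints
    have hq : q ≤ A ^ 2 * p := by
      by_contra! hlt'
      have hA1 : 1 ≤ A ^ 2 := by nlinarith
      obtain ⟨x, hpx, hx⟩ : ∃ x, p < x ∧ A ^ 2 * x < q := by
        obtain ⟨x, h3, h4⟩ := exists_between ((lt_div_iff₀' (by positivity : 0 < A ^ 2)).2 hlt')
        exact ⟨x, h3, (lt_div_iff₀' (by positivity)).1 h4⟩
      obtain ⟨y, hxy, hy⟩ := exists_between hx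
      have hx0 : 0 < x := hp.trans hpx
      have hxy' : x < y := by nlinarith
      have := hratio x ⟨hpx, hxy'.trans hy⟩ y ⟨hpx.trans hxy', hy⟩ hxy'.le
      linarith
    have := norm_integral_le_of_le_mul (P := monomialSum s b) hp hpq hq
    linarith

/-- The bound of the contribution of the large values of `t` for `n` monomials. -/
def largeBound (n : ℕ) : ℝ :=
  2 ^ (n * n) * (4 + 12 * n + (2 * n + 2) ^ 2)

lemma largeBound_mono {m n : ℕ} (h : m ≤ n) : largeBound m ≤ largeBound n := by
  unfold largeBound
  gcongr
  norm_num

open Set in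
/-- The one-sided estimate over an interval on which `t P'(t)` has a term of size at least `1`. -/
lemma norm_integral_le_largeBound {s : Finset ℕ} {b : ℕ → ℝ} {p q : ℝ} (hp : 0 < p) (hpq : p ≤ q)
    (hlarge : ∀ t ∈ Ioo p q, ∃ k ∈ s, 1 ≤ termSize b k t) :
    ‖∫ t in p..q, Complex.exp (Complex.I * (monomialSum s b t : ℂ)) / (t : ℂ)‖
      ≤ largeBound s.card := by
  have hc : ContinuousOn (fun t : ℝ => Complex.exp (Complex.I * (monomialSum s b t : ℂ)) / (t : ℂ))
      (Icc p q) := by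
    refine ContinuousOn.div (by fun_prop) (by fun_prop) fun t ht => ?_
    exact_mod_cast (hp.trans_le ht.1).ne'
  have key := norm_intervalIntegral_le_of_cuts (s ×ˢ s)
    (fun x => {t | (2 * s.card + 2) * termSize b x.2 t ≤ termSize b x.1 t}) hpq hc
    (C := 4 + 12 * s.card + (2 * s.card + 2) ^ 2) ?_ ?_
  · rwa [Finset.card_product] at key
  · rintro ⟨i, j⟩ -
    have hi : 0 ≤ i * |b i| := by positivity
    have hj : 0 ≤ (2 * s.card + 2) * (j * |b j|) := by positivity
    simp only [mem_ofPred_eq, termSize, ← mul_assoc]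
    simp only [← mul_assoc] at hj
    rcases le_total i j with h | h
    · exact .inl fun x y hx hxy _ hy => mul_pow_le_mul_pow_of_le h hj (hp.trans_le hx) hxy hy
    · exact .inr fun x y hx hxy _ hy => mul_pow_le_mul_pow_of_ge h hi (hp.trans_le hx) hxy hy
  · intro p' q' hp' hpq' hq' hreg
    exact norm_integral_le_of_regimes (hp.trans_le hp') hpq'
      (fun t ht => hlarge t (Ioo_subset_Ioo hp' hq' ht))
      fun i hi j hj => hreg (i, j) (Finset.mk_mem_product hi hj)

/-- The bound for the truncated integrals of `e^{iP(t)} / t` for `n` monomials. -/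
def phaseBound (n : ℕ) : ℝ :=
  2 * n + 2 * largeBound n

lemma monomialSum_neg (s : Finset ℕ) (b : ℕ → ℝ) (t : ℝ) :
    monomialSum s b (-t) = monomialSum s (fun k => (-1) ^ k * b k) t := by
  unfold monomialSum
  refine Finset.sum_congr rfl fun k _ => ?_
  rw [neg_pow]; ring

lemma norm_exp_sub_exp_le (x y : ℝ) :
    ‖Complex.exp (Complex.I * (x : ℂ)) - Complex.exp (Complex.I * (y : ℂ))‖ ≤ |x - y| := by
  have h : Complex.exp (Complex.I * (x : ℂ)) - Complex.exp (Complex.I * (y : ℂ)) =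
      Complex.exp (Complex.I * (y : ℂ)) * (Complex.exp (Complex.I * ((x - y : ℝ) : ℂ)) - 1) := by
    rw [mul_sub, ← Complex.exp_add, mul_one]; push_cast; ring_nf
  rw [h, norm_mul, Complex.norm_exp_I_mul_ofReal, one_mul]
  exact Real.norm_exp_I_mul_ofReal_sub_one_le

open Set in
/-- On an interval where all terms of `t P'(t)` are at most `1`, the cancellation of `dt / t`
suffices. -/
lemma norm_integral_le_of_small {s : Finset ℕ} {b : ℕ → ℝ} (hs : 0 ∉ s) {p q : ℝ} (hp : 0 < p)
    (hpq : p ≤ q) (hsmall : ∀ t ∈ Ioo p q, ∀ k ∈ s, termSize b k t ≤ 1) :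
    ‖∫ t in p..q, (Complex.exp (Complex.I * (monomialSum s b t : ℂ)) -
      Complex.exp (Complex.I * (monomialSum s b (-t) : ℂ))) / (t : ℂ)‖ ≤ 2 * s.card := by
  rcases hpq.eq_or_lt with rfl | hlt
  · simp
  have hq : ∀ k ∈ s, termSize b k q ≤ 1 := fun k hk => by
    have hcl : IsClosed {t | termSize b k t ≤ 1} := isClosed_le (by fun_prop) (by fun_prop)
    have : Icc p q ⊆ {t | termSize b k t ≤ 1} := by
      rw [← closure_Ioo hlt.ne]
      exact hcl.closure_subset_iff.2 fun t ht => hsmall t ht k hk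
    exact this ⟨hpq, le_rfl⟩
  have hd : ∀ k, ∀ t ∈ uIcc p q, HasDerivAt (termSize b k) (k * termSize b k t / t) t := by
    intro k t ht
    rw [uIcc_of_le hpq] at ht
    exact hasDerivAt_const_mul_pow _ _ (hp.trans_le ht.1).ne'
  have hi : ∀ k, IntervalIntegrable (fun t => k * termSize b k t / t) volume p q := fun k =>
    (ContinuousOn.div (by fun_prop) continuousOn_id
      fun t ht => (hp.trans_le ht.1).ne').intervalIntegrable_of_Icc hpq
  have hsum : IntervalIntegrable (fun t => 2 * ∑ k ∈ s, k * termSize b k t / t) volume p q := by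
    refine IntervalIntegrable.const_mul ?_ _
    simpa only [Finset.sum_fn] using IntervalIntegrable.sum s fun i _ => hi i
  refine (intervalIntegral.norm_integral_le_of_norm_le hpq
    (Filter.Eventually.of_forall fun t ht => ?_) hsum).trans ?_
  · have h0 : 0 < t := hp.trans ht.1
    rw [norm_div, Complex.norm_real, Real.norm_eq_abs, abs_of_pos h0, ← Finset.sum_div,
      mul_div_assoc']
    refine div_le_div_of_nonneg_right ((norm_exp_sub_exp_le _ _).trans ?_) h0.le
    have hle : ∀ x : ℝ, |x| = t → |monomialSum s b x| ≤ ∑ k ∈ s, k * termSize b k t := by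
      intro x hx
      refine (Finset.abs_sum_le_sum_abs _ _).trans (Finset.sum_le_sum fun k hk => ?_)
      have hk1 : (1 : ℝ) ≤ k := by
        exact_mod_cast Nat.one_le_iff_ne_zero.2 fun h => hs (h ▸ hk)
      rw [abs_mul, abs_pow, hx, termSize]
      have : 0 ≤ |b k| * t ^ k := by positivity
      nlinarith [mul_le_mul hk1 hk1 zero_le_one (by linarith)]
    have h1 := hle t (abs_of_pos h0)
    have h2 := hle (-t) (by rw [abs_neg, abs_of_pos h0])
    have h3 := abs_sub (monomialSum s b t) (monomialSum s b (-t))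
    linarith
  · rw [intervalIntegral.integral_const_mul, intervalIntegral.integral_finsetSum fun i _ => hi i,
      Finset.sum_congr rfl fun i _ => intervalIntegral.integral_eq_sub_of_hasDerivAt (hd i) (hi i)]
    have := Finset.sum_le_card_nsmul s (fun k => termSize b k q - termSize b k p) 1 fun k hk => by
      have h1 := hq k hk
      have h2 := termSize_nonneg b k hp.le
      linarith
    rw [nsmul_eq_mul] at this
    linarith

open Set in
/-- The principal value integrals of `e^{iP(t)} / t`, doubly truncated, are bounded in terms of the
number of monomials of `P` only. -/
theorem norm_integral_le_phaseBound {n : ℕ} {s : Finset ℕ} (hn : s.card ≤ n) (hs : 0 ∉ s)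
    (b : ℕ → ℝ) {p q : ℝ} (hp : 0 < p) (hpq : p ≤ q) :
    ‖∫ t in p..q, (Complex.exp (Complex.I * (monomialSum s b t : ℂ)) -
      Complex.exp (Complex.I * (monomialSum s b (-t) : ℂ))) / (t : ℂ)‖ ≤ phaseBound n := by
  obtain ⟨c, ⟨hpc, hcq⟩, h1, h2⟩ := exists_cut_of_lower
    (S := {t | ∀ k ∈ s, termSize b k t ≤ 1}) hpq (fun x y hx hxy _ hy k hk => by
      have hx0 : 0 < x := hp.trans_le hx
      refine le_trans ?_ (hy k hk)
      unfold termSize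
      gcongr)
  have hc0 : 0 < c := hp.trans_le hpc
  have hc : ∀ x y, 0 < x → x ≤ y → ∀ b : ℕ → ℝ, IntervalIntegrable
      (fun t : ℝ => Complex.exp (Complex.I * (monomialSum s b t : ℂ)) / (t : ℂ)) volume x y := by
    intro x y hx hxy b
    refine ContinuousOn.intervalIntegrable_of_Icc hxy
      (ContinuousOn.div (by fun_prop) (by fun_prop) fun t ht => ?_)
    exact_mod_cast (hx.trans_le ht.1).ne'
  have hlarge : ∀ t ∈ Ioo c q, ∃ k ∈ s, 1 ≤ termSize b k t := by
    intro t ht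
    have := h2 ht
    simp only [mem_compl_iff, mem_ofPred_eq, not_forall, not_le] at this
    obtain ⟨k, hk, h⟩ := this
    exact ⟨k, hk, h.le⟩
  have hsize : ∀ k t, termSize (fun k => (-1) ^ k * b k) k t = termSize b k t := by
    intro k t
    simp [termSize, abs_mul]
  have e1 := norm_integral_le_of_small hs hp hpc fun t ht => h1 ht
  have e2 := norm_integral_le_largeBound hc0 hcq hlarge
  have e3 := norm_integral_le_largeBound (b := fun k => (-1) ^ k * b k) hc0 hcq
    (by simpa only [hsize] using hlarge)
  simp only [monomialSum_neg, sub_div] at e1 ⊢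
  rw [← intervalIntegral.integral_add_adjacent_intervals
    ((hc p c hp hpc b).sub (hc p c hp hpc _)) ((hc c q hc0 hcq b).sub (hc c q hc0 hcq _)),
    intervalIntegral.integral_sub (hc c q hc0 hcq b) (hc c q hc0 hcq _)]
  have hm := largeBound_mono hn
  have hn' : (s.card : ℝ) ≤ n := by exact_mod_cast hn
  unfold phaseBound
  refine (norm_add_le _ _).trans ?_
  have := norm_sub_le
    (∫ t in c..q, Complex.exp (Complex.I * (monomialSum s b t : ℂ)) / (t : ℂ))
    (∫ t in c..q, Complex.exp (Complex.I *
      (monomialSum s (fun k => (-1) ^ k * b k) t : ℂ)) / (t : ℂ))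
  linarith

/-! ### Convolution operators on `L²` -/

/-- The convolution `x ↦ ∫ k t * f (x - t) dt` of two complex-valued functions on the line. -/
noncomputable def cconv (k f : ℝ → ℂ) : ℝ → ℂ :=
  k ⋆[ContinuousLinearMap.mul ℂ ℂ, volume] f

lemma cconv_apply (k f : ℝ → ℂ) (x : ℝ) : cconv k f x = ∫ t, k t * f (x - t) :=
  convolution_mul

lemma memLp_comp_sub_left {f : ℝ → ℂ} {p : ℝ≥0∞} (hf : MemLp f p) (x : ℝ) :
    MemLp (fun t => f (x - t)) p :=
  hf.comp_measurePreserving (Measure.measurePreserving_sub_left volume x)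

lemma eLpNorm_comp_sub_left {f : ℝ → ℂ} {p : ℝ≥0∞} (hf : MemLp f p) (x : ℝ) :
    eLpNorm (fun t => f (x - t)) p = eLpNorm f p :=
  eLpNorm_comp_measurePreserving hf.1 (Measure.measurePreserving_sub_left volume x)

lemma integrable_mul_comp_sub_left {k f : ℝ → ℂ} (hk : MemLp k 2) (hf : MemLp f 2) (x : ℝ) :
    Integrable (fun t => k t * f (x - t)) :=
  MemLp.integrable_mul (p := 2) (q := 2) hk (memLp_comp_sub_left hf x)

lemma enorm_integral_mul_le {k f : ℝ → ℂ} (hk : MemLp k 2) (hf : MemLp f 2) :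
    ‖∫ t, k t * f t‖ₑ ≤ eLpNorm k 2 * eLpNorm f 2 := by
  refine (enorm_integral_le_lintegral_enorm _).trans ?_
  rw [← eLpNorm_one_eq_lintegral_enorm]
  have := eLpNorm_smul_le_mul_eLpNorm (p := 2) (q := 2) (r := 1) hf.1 hk.1
  exact this

lemma enorm_cconv_le {k f : ℝ → ℂ} (hk : MemLp k 2) (hf : MemLp f 2) (x : ℝ) :
    ‖cconv k f x‖ₑ ≤ eLpNorm k 2 * eLpNorm f 2 := by
  rw [cconv_apply, ← eLpNorm_comp_sub_left hf x]
  exact enorm_integral_mul_le hk (memLp_comp_sub_left hf x)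

lemma aestronglyMeasurable_cconv {k f : ℝ → ℂ} (hk : MemLp k 2) (hf : MemLp f 2) :
    AEStronglyMeasurable (cconv k f) := by
  have := (hk.1.convolution_integrand (ContinuousLinearMap.mul ℂ ℂ) (μ := volume) hf.1)
  exact this.integral_prod_right'

lemma cconv_sub_left {k l f : ℝ → ℂ} (hk : MemLp k 2) (hl : MemLp l 2) (hf : MemLp f 2) (x : ℝ) :
    cconv (k - l) f x = cconv k f x - cconv l f x := by
  simp only [cconv_apply, Pi.sub_apply, sub_mul]
  exact integral_sub (integrable_mul_comp_sub_left hk hf x) (integrable_mul_comp_sub_left hl hf x)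

lemma cconv_sub_right {k f g : ℝ → ℂ} (hk : MemLp k 2) (hf : MemLp f 2) (hg : MemLp g 2) (x : ℝ) :
    cconv k (f - g) x = cconv k f x - cconv k g x := by
  simp only [cconv_apply, Pi.sub_apply, mul_sub]
  exact integral_sub (integrable_mul_comp_sub_left hk hf x) (integrable_mul_comp_sub_left hk hg x)

/-- Convolution with a fixed `L²` function maps `L²` convergence to pointwise convergence. -/
lemma tendsto_cconv_right {ι : Type*} {l : Filter ι} {k f : ℝ → ℂ} {F : ι → ℝ → ℂ}
    (hk : MemLp k 2) (hF : ∀ i, MemLp (F i) 2) (hf : MemLp f 2)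
    (h : Tendsto (fun i => eLpNorm (F i - f) 2) l (𝓝 0)) (x : ℝ) :
    Tendsto (fun i => cconv k (F i) x) l (𝓝 (cconv k f x)) := by
  rw [tendsto_iff_edist_tendsto_0]
  have h0 : Tendsto (fun i => eLpNorm k 2 * eLpNorm (F i - f) 2) l (𝓝 0) := by
    simpa using ENNReal.Tendsto.const_mul h (.inr hk.eLpNorm_ne_top)
  refine tendsto_of_tendsto_of_tendsto_of_le_of_le tendsto_const_nhds h0
    (fun _ => zero_le) fun i => ?_
  rw [edist_eq_enorm_sub, ← cconv_sub_right hk (hF i) hf]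
  exact enorm_cconv_le hk ((hF i).sub hf) x

/-- Half of Plancherel's theorem: an integrable square-integrable function has `L²` norm at most
that of its Fourier integral. It is obtained from the density of Schwartz functions in `L²`. -/
lemma eLpNorm_two_le_eLpNorm_fourier {g : ℝ → ℂ} (hg : Integrable g) (hg2 : MemLp g 2)
    (hF : MemLp (𝓕 g) 2) : eLpNorm g 2 ≤ eLpNorm (𝓕 g) 2 := by
  have key : ∀ φ : Lp ℂ 2 (volume : Measure ℝ),
      ‖inner ℂ (hg2.toLp g) φ‖ ≤ ‖hF.toLp (𝓕 g)‖ * ‖φ‖ := by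
    intro φ
    refine DenseRange.induction_on
      (p := fun φ : Lp ℂ 2 (volume : Measure ℝ) =>
        ‖inner ℂ (hg2.toLp g) φ‖ ≤ ‖hF.toLp (𝓕 g)‖ * ‖φ‖)
      (SchwartzMap.denseRange_toLpCLM (p := 2) ENNReal.ofNat_ne_top) φ
      (isClosed_le (by fun_prop) (by fun_prop)) fun ψ => ?_
    have h1 : inner ℂ (hg2.toLp g) (ψ.toLp 2) = inner ℂ (hF.toLp (𝓕 g)) ((𝓕 ψ).toLp 2) := by
      rw [L2.inner_def, L2.inner_def]
      have e1 : ∫ a, inner ℂ (hg2.toLp g a) (ψ.toLp 2 volume a) = ∫ a, inner ℂ (g a) (ψ a) := by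
        refine integral_congr_ae ?_
        filter_upwards [hg2.coeFn_toLp, ψ.coeFn_toLp 2 volume] with a h1 h2
        rw [h1, h2]
      have e2 : ∫ a, inner ℂ (hF.toLp (𝓕 g) a) ((𝓕 ψ).toLp 2 volume a) =
          ∫ a, inner ℂ (𝓕 g a) ((𝓕 ψ : 𝓢(ℝ, ℂ)) a) := by
        refine integral_congr_ae ?_
        have h3 := (𝓕 ψ : 𝓢(ℝ, ℂ)).coeFn_toLp 2 volume
        filter_upwards [hF.coeFn_toLp, h3] with a h1 h2
        rw [h1, h2]
      have e3 : ∀ x, VectorFourier.fourierIntegral Real.fourierChar volume (-(innerₗ ℝ).flip)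
          (𝓕 ψ : 𝓢(ℝ, ℂ)) x = ψ x := by
        intro x
        have : 𝓕⁻ (𝓕 ψ) = ψ := FourierTransform.fourierInv_fourier_eq ψ
        conv_rhs => rw [← this, SchwartzMap.fourierInv_coe]
        simp [Real.fourierInv_eq, VectorFourier.fourierIntegral]
      rw [e1, e2]
      have := VectorFourier.integral_sesq_fourierIntegral_eq_neg_flip (innerSL ℂ (E := ℂ))
        (L := innerₗ ℝ) Real.continuous_fourierChar continuous_inner hg
        ((𝓕 ψ : 𝓢(ℝ, ℂ)).integrable (μ := volume))
      simp only [e3] at this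
      exact this.symm
    change ‖inner ℂ (hg2.toLp g) (ψ.toLp 2)‖ ≤ _ * ‖ψ.toLp 2‖
    rw [h1, ← SchwartzMap.norm_fourier_toL2_eq ψ]
    exact norm_inner_le_norm _ _
  have h := key (hg2.toLp g)
  rw [inner_self_eq_norm_sq_to_K, norm_pow, RCLike.norm_ofReal, abs_norm, sq] at h
  have h' : ‖hg2.toLp g‖ ≤ ‖hF.toLp (𝓕 g)‖ := by
    rcases (norm_nonneg (hg2.toLp g)).eq_or_lt with h0 | h0
    · rw [← h0]; positivity
    · exact le_of_mul_le_mul_right h h0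
  rw [Lp.norm_toLp, Lp.norm_toLp] at h'
  exact (ENNReal.toReal_le_toReal hg2.eLpNorm_ne_top hF.eLpNorm_ne_top).1 h'

/-- The `L²` norm of `k * f` for a Schwartz function `f` is controlled by any majorant of the
product of the Fourier integrals. -/
lemma eLpNorm_cconv_schwartz_le {k : ℝ → ℂ} (hk : Integrable k) (hk2 : MemLp k 2) (f : 𝓢(ℝ, ℂ))
    {h : ℝ → ℂ} (hh : MemLp h 2) (hle : ∀ ξ, ‖𝓕 k ξ * 𝓕 (f : ℝ → ℂ) ξ‖ ≤ ‖h ξ‖) :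
    eLpNorm (cconv k f) 2 ≤ eLpNorm h 2 := by
  have hf2 : MemLp f 2 := f.memLp 2 volume
  have hint : Integrable (cconv k f) := hk.integrable_convolution _ f.integrable
  have hfin : eLpNorm k 2 * eLpNorm f 2 ≠ ∞ :=
    ENNReal.mul_ne_top hk2.eLpNorm_ne_top hf2.eLpNorm_ne_top
  have hg2 : MemLp (cconv k f) 2 := by
    rw [memLp_two_iff_integrable_sq_norm hint.1]
    refine (hint.norm.const_mul (eLpNorm k 2 * eLpNorm f 2).toReal).mono'
      (hint.1.norm.pow 2) (Eventually.of_forall fun x => ?_)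
    have : ‖cconv k f x‖ ≤ (eLpNorm k 2 * eLpNorm f 2).toReal := by
      rw [← toReal_enorm]
      exact ENNReal.toReal_mono hfin (enorm_cconv_le hk2 hf2 x)
    rw [Real.norm_eq_abs, abs_of_nonneg (by positivity), sq]
    gcongr
  have hF : 𝓕 (cconv k f) = fun ξ => 𝓕 k ξ * 𝓕 (f : ℝ → ℂ) ξ :=
    funext fun ξ => Real.fourier_mul_convolution_eq hk f.integrable ξ
  have hcont : ∀ {g : ℝ → ℂ}, Integrable g → Continuous (𝓕 g) := fun hg =>
    VectorFourier.fourierIntegral_continuous Real.continuous_fourierChar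
      (L := innerₗ ℝ) continuous_inner hg
  have hFm : MemLp (𝓕 (cconv k f)) 2 :=
    hh.of_le (hcont hint).aestronglyMeasurable (Eventually.of_forall fun ξ => by
      rw [hF]; exact hle ξ)
  refine (eLpNorm_two_le_eLpNorm_fourier hint hg2 hFm).trans (eLpNorm_mono fun ξ => ?_)
  rw [hF]; exact hle ξ

/-- Every `L²` function is an `L²` limit of Schwartz functions. -/
lemma exists_schwartz_tendsto {f : ℝ → ℂ} (hf : MemLp f 2) :
    ∃ φ : ℕ → 𝓢(ℝ, ℂ), Tendsto (fun n => eLpNorm (⇑(φ n) - f) 2) atTop (𝓝 0) := by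
  have hmem := SchwartzMap.denseRange_toLpCLM (E := ℝ) (F := ℂ) (p := 2) (μ := volume)
    ENNReal.ofNat_ne_top (hf.toLp f)
  obtain ⟨u, hu, hlim⟩ := mem_closure_iff_seq_limit.1 hmem
  choose φ hφ using hu
  refine ⟨φ, ?_⟩
  rw [tendsto_iff_edist_tendsto_0] at hlim
  refine hlim.congr fun n => ?_
  rw [← hφ n]
  exact Lp.edist_toLp_toLp _ _ ((φ n).memLp 2 volume) hf

lemma eLpNorm_fourier_schwartz (f : 𝓢(ℝ, ℂ)) :
    eLpNorm (𝓕 (f : ℝ → ℂ)) 2 = eLpNorm f 2 := by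
  have h := SchwartzMap.norm_fourier_toL2_eq f
  rw [SchwartzMap.norm_toLp, SchwartzMap.norm_toLp, SchwartzMap.fourier_coe] at h
  refine (ENNReal.toReal_eq_toReal_iff' ?_ (f.memLp 2 volume).eLpNorm_ne_top).1 h
  rw [← SchwartzMap.fourier_coe]
  exact ((𝓕 f).memLp 2 volume).eLpNorm_ne_top

lemma memLp_fourier_schwartz (f : 𝓢(ℝ, ℂ)) : MemLp (𝓕 (f : ℝ → ℂ)) 2 := by
  rw [← SchwartzMap.fourier_coe]
  exact (𝓕 f).memLp 2 volume

/-- A Fatou-type criterion: a uniform `L²` bound passes to the pointwise limit. -/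
lemma eLpNorm_le_of_tendsto {F : ℕ → ℝ → ℂ} {g : ℝ → ℂ} {u : ℕ → ℝ≥0∞} {M : ℝ≥0∞}
    (hF : ∀ n, AEStronglyMeasurable (F n)) (hlim : ∀ᵐ x, Tendsto (fun n => F n x) atTop (𝓝 (g x)))
    (hle : ∀ n, eLpNorm (F n) 2 ≤ u n) (hu : Tendsto u atTop (𝓝 M)) : eLpNorm g 2 ≤ M := by
  refine (Lp.eLpNorm_lim_le_liminf_eLpNorm hF g hlim).trans ?_
  rw [← hu.liminf_eq]
  exact liminf_le_liminf (Eventually.of_forall hle)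

/-- Convolution with a kernel whose Fourier integral is at most `C` is bounded on `L²` with norm
at most `C`. -/
theorem eLpNorm_cconv_le {k : ℝ → ℂ} (hk : Integrable k) (hk2 : MemLp k 2) {C : ℝ≥0}
    (hC : ∀ ξ, ‖𝓕 k ξ‖ ≤ C) {f : ℝ → ℂ} (hf : MemLp f 2) :
    eLpNorm (cconv k f) 2 ≤ C * eLpNorm f 2 := by
  obtain ⟨φ, hφ⟩ := exists_schwartz_tendsto hf
  have hS : ∀ φ : 𝓢(ℝ, ℂ), eLpNorm (cconv k φ) 2 ≤ C * eLpNorm φ 2 := by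
    intro φ
    refine (eLpNorm_cconv_schwartz_le hk hk2 φ (h := (C : ℂ) • 𝓕 (φ : ℝ → ℂ))
      ((memLp_fourier_schwartz φ).const_smul _) fun ξ => ?_).trans (le_of_eq ?_)
    · rw [Pi.smul_apply, norm_smul, norm_mul]
      gcongr
      simpa using hC ξ
    · rw [eLpNorm_const_smul, eLpNorm_fourier_schwartz]
      congr 1
      rw [← ofReal_norm, show ‖((C : ℝ) : ℂ)‖ = C by simp, ENNReal.ofReal_coe_nnreal]
  have hnorm : Tendsto (fun n => (C : ℝ≥0∞) * (eLpNorm (⇑(φ n) - f) 2 + eLpNorm f 2)) atTop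
      (𝓝 (C * eLpNorm f 2)) := by
    have h := hφ.add_const (eLpNorm f 2)
    rw [zero_add] at h
    exact ENNReal.Tendsto.const_mul h (.inr ENNReal.coe_ne_top)
  refine eLpNorm_le_of_tendsto (fun n => aestronglyMeasurable_cconv hk2 ((φ n).memLp 2 volume))
    (Eventually.of_forall fun x => tendsto_cconv_right hk2 (fun n => (φ n).memLp 2 volume) hf hφ x)
    (fun n => (hS (φ n)).trans ?_) hnorm
  gcongr
  have := eLpNorm_add_le (p := 2) (((φ n).memLp 2 volume).sub hf).1 hf.1 (by norm_num)
  simpa using this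

/-! ### The truncated kernels and their multipliers -/

/-- The complement of the interval of radius `ε` around the origin. -/
def outerSet (ε : ℝ) : Set ℝ :=
  {t | ε < |t|}

/-- The points at distance more than `ε` and at most `R` from the origin. -/
def annulus (ε R : ℝ) : Set ℝ :=
  {t | ε < |t| ∧ |t| ≤ R}

/-- The kernel `e^{iQ(t)} / t`, restricted to the set `S`. -/
noncomputable def oscKernel (Q : ℝ → ℝ) (S : Set ℝ) : ℝ → ℂ :=
  S.indicator fun t => Complex.exp (Complex.I * (Q t : ℂ)) / (t : ℂ)

lemma measurableSet_outerSet (ε : ℝ) : MeasurableSet (outerSet ε) :=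
  measurableSet_lt measurable_const measurable_id.abs

lemma measurableSet_annulus (ε R : ℝ) : MeasurableSet (annulus ε R) :=
  (measurableSet_outerSet ε).inter (measurableSet_le measurable_id.abs measurable_const)

lemma annulus_subset_outerSet (ε R : ℝ) : annulus ε R ⊆ outerSet ε := fun _ h => h.1

lemma measurable_oscKernel {Q : ℝ → ℝ} (hQ : Measurable Q) {S : Set ℝ} (hS : MeasurableSet S) :
    Measurable (oscKernel Q S) := by
  refine Measurable.indicator ?_ hS
  fun_prop

lemma norm_oscKernel_le (Q : ℝ → ℝ) (S : Set ℝ) (t : ℝ) :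
    ‖oscKernel Q S t‖ ≤ S.indicator (fun t => |t|⁻¹) t := by
  unfold oscKernel
  by_cases h : t ∈ S
  · rw [Set.indicator_of_mem h, Set.indicator_of_mem h, norm_div, Complex.norm_exp_I_mul_ofReal,
      Complex.norm_real, Real.norm_eq_abs, one_div]
  · simp [h]

lemma memLp_oscKernel_of_subset {Q : ℝ → ℝ} (hQ : Measurable Q) {S : Set ℝ} (hS : MeasurableSet S)
    {ε : ℝ} (hε : 0 < ε) (hsub : S ⊆ outerSet ε) : MemLp (oscKernel Q S) 2 := by
  have hm := measurable_oscKernel hQ hS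
  rw [memLp_two_iff_integrable_sq_norm hm.aestronglyMeasurable]
  refine (integrable_inv_one_add_sq.const_mul (1 + (ε ^ 2)⁻¹)).mono'
    (hm.norm.pow_const 2).aestronglyMeasurable (Eventually.of_forall fun t => ?_)
  rw [Real.norm_eq_abs, abs_of_nonneg (by positivity)]
  by_cases h : t ∈ S
  · have ht : ε < |t| := hsub h
    have h1 := norm_oscKernel_le Q S t
    rw [Set.indicator_of_mem h] at h1
    have h2 : ε ^ 2 ≤ t ^ 2 := by rw [← sq_abs t]; gcongr
    have h3 : 0 < t ^ 2 := lt_of_lt_of_le (by positivity) h2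
    calc ‖oscKernel Q S t‖ ^ 2 ≤ (|t|⁻¹) ^ 2 := by gcongr
      _ = (t ^ 2)⁻¹ := by rw [inv_pow, sq_abs]
      _ ≤ (1 + (ε ^ 2)⁻¹) * (1 + t ^ 2)⁻¹ := by
        rw [← div_eq_mul_inv, le_div_iff₀ (by positivity), ← div_eq_inv_mul,
          div_le_iff₀ h3]
        have : 1 ≤ (ε ^ 2)⁻¹ * t ^ 2 := by
          rw [← div_eq_inv_mul, le_div_iff₀ (by positivity)]; linarith
        linarith
  · simp only [oscKernel, Set.indicator_of_notMem h]
    simp; positivity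

lemma memLp_oscKernel_outerSet {Q : ℝ → ℝ} (hQ : Measurable Q) {ε : ℝ} (hε : 0 < ε) :
    MemLp (oscKernel Q (outerSet ε)) 2 :=
  memLp_oscKernel_of_subset hQ (measurableSet_outerSet ε) hε subset_rfl

lemma memLp_oscKernel_annulus {Q : ℝ → ℝ} (hQ : Measurable Q) {ε : ℝ} (hε : 0 < ε) (R : ℝ) :
    MemLp (oscKernel Q (annulus ε R)) 2 :=
  memLp_oscKernel_of_subset hQ (measurableSet_annulus ε R) hε (annulus_subset_outerSet ε R)

lemma annulus_subset_Icc (ε R : ℝ) : annulus ε R ⊆ Set.Icc (-R) R := fun _ h => abs_le.1 h.2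

lemma integrableOn_annulus {Q : ℝ → ℝ} (hQ : Measurable Q) {ε : ℝ} (hε : 0 < ε) (R : ℝ) :
    IntegrableOn (fun t : ℝ => Complex.exp (Complex.I * (Q t : ℂ)) / (t : ℂ)) (annulus ε R) := by
  refine Measure.integrableOn_of_bounded (M := ε⁻¹) ?_
    (Measurable.aestronglyMeasurable (by fun_prop)) ?_
  · exact ((measure_mono (annulus_subset_Icc ε R)).trans_lt
      (by simp [Real.volume_Icc])).ne
  · filter_upwards [ae_restrict_mem (measurableSet_annulus ε R)] with t ht
    rw [norm_div, Complex.norm_exp_I_mul_ofReal, Complex.norm_real, Real.norm_eq_abs, one_div]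
    exact inv_anti₀ hε ht.1.le

lemma integrable_oscKernel_annulus {Q : ℝ → ℝ} (hQ : Measurable Q) {ε : ℝ} (hε : 0 < ε) (R : ℝ) :
    Integrable (oscKernel Q (annulus ε R)) :=
  (integrable_indicator_iff (measurableSet_annulus ε R)).2 (integrableOn_annulus hQ hε R)

/-- An integral over an annulus is folded onto the positive half-line. -/
lemma setIntegral_annulus {g : ℝ → ℂ} {ε R : ℝ} (hε : 0 < ε) (hR : ε ≤ R)
    (hg : IntegrableOn g (annulus ε R)) :
    ∫ t in annulus ε R, g t = ∫ t in ε..R, (g t + g (-t)) := by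
  have hU : annulus ε R = Set.Ioc ε R ∪ Set.Ico (-R) (-ε) := by
    ext t
    simp only [annulus, Set.mem_ofPred_eq, Set.mem_union, Set.mem_Ioc, Set.mem_Ico]
    constructor
    · rintro ⟨h1, h2⟩
      rcases abs_cases t with ⟨h, h'⟩ | ⟨h, h'⟩
      · exact .inl ⟨h ▸ h1, h ▸ h2⟩
      · exact .inr ⟨by linarith, by linarith⟩
    · rintro (⟨h1, h2⟩ | ⟨h1, h2⟩)
      · rw [abs_of_pos (by linarith)]; exact ⟨h1, h2⟩
      · rw [abs_of_neg (by linarith)]; exact ⟨by linarith, by linarith⟩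
  have hd : Disjoint (Set.Ioc ε R) (Set.Ico (-R) (-ε)) :=
    Set.disjoint_left.2 fun t h1 h2 => by linarith [h1.1, h2.2]
  have h1 : IntegrableOn g (Set.Ioc ε R) := hg.mono_set (hU ▸ Set.subset_union_left)
  have h2 : IntegrableOn g (Set.Ico (-R) (-ε)) := hg.mono_set (hU ▸ Set.subset_union_right)
  have i1 : IntervalIntegrable g volume ε R :=
    (intervalIntegrable_iff_integrableOn_Ioc_of_le hR).2 h1
  have i2 : IntervalIntegrable g volume (-R) (-ε) :=
    (intervalIntegrable_iff_integrableOn_Ico_of_le (by linarith)).2 h2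
  have i3 : IntervalIntegrable (fun t => g (-t)) volume ε R := by
    simpa using ((IntervalIntegrable.iff_comp_neg (by finiteness)).1 i2).symm
  rw [hU, setIntegral_union hd measurableSet_Ico h1 h2, intervalIntegral.integral_add i1 i3,
    intervalIntegral.integral_comp_neg, intervalIntegral.integral_of_le hR,
    intervalIntegral.integral_of_le (by linarith : -R ≤ -ε), integral_Ico_eq_integral_Ioc]

/-- The Fourier integral of the doubly truncated kernel is a doubly truncated oscillatory integral
whose phase has an additional linear term. -/
lemma fourier_oscKernel_annulus {Q : ℝ → ℝ} (hQ : Measurable Q) {ε R : ℝ} (hε : 0 < ε)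
    (hR : ε ≤ R) (ξ : ℝ) :
    𝓕 (oscKernel Q (annulus ε R)) ξ =
      ∫ t in ε..R, (Complex.exp (Complex.I * ((Q t - 2 * Real.pi * ξ * t : ℝ) : ℂ)) -
        Complex.exp (Complex.I * ((Q (-t) - 2 * Real.pi * ξ * -t : ℝ) : ℂ))) / (t : ℂ) := by
  have h1 : 𝓕 (oscKernel Q (annulus ε R)) ξ = ∫ t in annulus ε R,
      Complex.exp (Complex.I * ((Q t - 2 * Real.pi * ξ * t : ℝ) : ℂ)) / (t : ℂ) := by
    rw [Real.fourier_real_eq_integral_exp_smul, ← integral_indicator (measurableSet_annulus ε R)]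
    congr 1 with t
    unfold oscKernel
    by_cases h : t ∈ annulus ε R
    · rw [Set.indicator_of_mem h, Set.indicator_of_mem h, smul_eq_mul, mul_div_assoc',
        ← Complex.exp_add]
      congr 2
      push_cast
      ring
    · simp [h]
  rw [h1, setIntegral_annulus hε hR (integrableOn_annulus (by fun_prop) hε R)]
  congr 1 with t
  rw [Complex.ofReal_neg t, div_neg, ← sub_eq_add_neg, sub_div]

/-- Subtracting a linear term adds at most one monomial, and no constant term. -/
lemma exists_monomialSum_sub_linear {s : Finset ℕ} (hs : 0 ∉ s) (b : ℕ → ℝ) (c : ℝ) :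
    ∃ s' : Finset ℕ, ∃ b' : ℕ → ℝ, 0 ∉ s' ∧ s'.card ≤ s.card + 1 ∧
      ∀ t, monomialSum s b t - c * t = monomialSum s' b' t := by
  classical
  refine ⟨insert 1 s, fun k => (if k ∈ s then b k else 0) - if k = 1 then c else 0, by simp [hs],
    Finset.card_insert_le _ _, fun t => ?_⟩
  simp only [monomialSum, sub_mul, Finset.sum_sub_distrib, ite_mul, zero_mul]
  congr 1
  · rw [← Finset.sum_filter]
    refine Finset.sum_congr ?_ fun _ _ => rfl
    ext k
    simp only [Finset.mem_filter, Finset.mem_insert]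
    tauto
  · simp

/-- The uniform bound for the multipliers of the doubly truncated operators. -/
lemma norm_fourier_oscKernel_annulus_le {s : Finset ℕ} (hs : 0 ∉ s) (b : ℕ → ℝ) {ε R : ℝ}
    (hε : 0 < ε) (hR : ε ≤ R) (ξ : ℝ) :
    ‖𝓕 (oscKernel (monomialSum s b) (annulus ε R)) ξ‖ ≤ phaseBound (s.card + 1) := by
  obtain ⟨s', b', hs', hcard, h⟩ := exists_monomialSum_sub_linear hs b (2 * Real.pi * ξ)
  rw [fourier_oscKernel_annulus (continuous_monomialSum s b).measurable hε hR]
  simp only [h]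
  exact norm_integral_le_phaseBound hcard hs' b' hε hR

lemma phaseBound_nonneg (n : ℕ) : 0 ≤ phaseBound n := by
  unfold phaseBound largeBound; positivity

/-- The uniform `L²` bound for the doubly truncated operators. -/
lemma eLpNorm_cconv_annulus_le {s : Finset ℕ} (hs : 0 ∉ s) (b : ℕ → ℝ) {ε R : ℝ}
    (hε : 0 < ε) (hR : ε ≤ R) {f : ℝ → ℂ} (hf : MemLp f 2) :
    eLpNorm (cconv (oscKernel (monomialSum s b) (annulus ε R)) f) 2 ≤
      (phaseBound (s.card + 1)).toNNReal * eLpNorm f 2 := by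
  have hm := (continuous_monomialSum s b).measurable
  refine eLpNorm_cconv_le (integrable_oscKernel_annulus hm hε R) (memLp_oscKernel_annulus hm hε R)
    (fun ξ => ?_) hf
  rw [Real.coe_toNNReal _ (phaseBound_nonneg _)]
  exact norm_fourier_oscKernel_annulus_le hs b hε hR ξ

lemma oscKernel_outerSet_sub {Q : ℝ → ℝ} {ε R : ℝ} (hR : ε ≤ R) :
    oscKernel Q (outerSet ε) - oscKernel Q (outerSet R) = oscKernel Q (annulus ε R) := by
  ext t
  simp only [Pi.sub_apply, oscKernel, Set.indicator_apply, outerSet, annulus, Set.mem_ofPred_eq]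
  by_cases h1 : R < |t|
  · simp [h1, hR.trans_lt h1]
  · by_cases h2 : ε < |t| <;> simp [h1, h2, not_lt.1 h1]

/-- The tails of the convolution integral tend to zero. -/
lemma tendsto_cconv_outerSet_atTop {Q : ℝ → ℝ} (hQ : Measurable Q) {f : ℝ → ℂ} (hf : MemLp f 2)
    (x : ℝ) : Tendsto (fun n : ℕ => cconv (oscKernel Q (outerSet (n + 1))) f x) atTop (𝓝 0) := by
  have hi := (integrable_mul_comp_sub_left (memLp_oscKernel_outerSet hQ one_pos) hf x).norm
  simp only [cconv_apply]
  rw [show (0 : ℂ) = ∫ t : ℝ, (0 : ℂ) by simp]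
  refine tendsto_integral_of_dominated_convergence _ (fun n => ?_) hi (fun n => ?_) ?_
  · exact (integrable_mul_comp_sub_left
      (memLp_oscKernel_outerSet hQ (by positivity : (0 : ℝ) < n + 1)) hf x).1
  · refine Eventually.of_forall fun t => ?_
    by_cases h : t ∈ outerSet (n + 1 : ℝ)
    · have h' : t ∈ outerSet 1 := by
        have : (n : ℝ) + 1 < |t| := h
        have hn : (0 : ℝ) ≤ n := Nat.cast_nonneg n
        change 1 < |t|
        linarith
      simp [oscKernel, h, h']
    · simp only [oscKernel, Set.indicator_of_notMem h, zero_mul, norm_zero]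
      positivity
  · refine Eventually.of_forall fun t => tendsto_const_nhds.congr' ?_
    obtain ⟨N, hN⟩ := exists_nat_gt |t|
    filter_upwards [eventually_ge_atTop N] with n hn
    have : t ∉ outerSet (n + 1 : ℝ) := by
      have : (N : ℝ) ≤ n := by exact_mod_cast hn
      change ¬ ((n : ℝ) + 1 < |t|)
      linarith
    simp [oscKernel, this]

/-- The uniform `L²` bound for the truncated operators. -/
lemma eLpNorm_cconv_outerSet_le {s : Finset ℕ} (hs : 0 ∉ s) (b : ℕ → ℝ) {ε : ℝ}
    (hε : 0 < ε) {f : ℝ → ℂ} (hf : MemLp f 2) :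
    eLpNorm (cconv (oscKernel (monomialSum s b) (outerSet ε)) f) 2 ≤
      (phaseBound (s.card + 1)).toNNReal * eLpNorm f 2 := by
  have hm := (continuous_monomialSum s b).measurable
  have hR : ∀ n : ℕ, ε ≤ max ε (n + 1) := fun n => le_max_left _ _
  refine eLpNorm_le_of_tendsto
    (F := fun n : ℕ => cconv (oscKernel (monomialSum s b) (annulus ε (max ε (n + 1)))) f)
    (fun n => aestronglyMeasurable_cconv (memLp_oscKernel_annulus hm hε _) hf)
    (Eventually.of_forall fun x => ?_)
    (fun n => eLpNorm_cconv_annulus_le hs b hε (hR n) hf) tendsto_const_nhds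
  have h := (tendsto_const_nhds
    (x := cconv (oscKernel (monomialSum s b) (outerSet ε)) f x)).sub
      (tendsto_cconv_outerSet_atTop hm hf x)
  rw [sub_zero] at h
  refine h.congr' ?_
  obtain ⟨N, hN⟩ := exists_nat_gt ε
  filter_upwards [eventually_ge_atTop N] with n hn
  have hle : ε ≤ n + 1 := by
    have : (N : ℝ) ≤ n := by exact_mod_cast hn
    linarith
  rw [max_eq_right hle, ← oscKernel_outerSet_sub hle,
    cconv_sub_left (memLp_oscKernel_outerSet hm hε)
      (memLp_oscKernel_outerSet hm (by positivity)) hf]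

/-! ### Convergence in `L²` of the truncated Hilbert transforms -/

/-- The kernel `1 / t` of the Hilbert transform, truncated to `ε < |t|`. -/
noncomputable def hilbertKernel (ε : ℝ) : ℝ → ℂ :=
  oscKernel (fun _ => 0) (outerSet ε)

lemma memLp_hilbertKernel {ε : ℝ} (hε : 0 < ε) : MemLp (hilbertKernel ε) 2 :=
  memLp_oscKernel_outerSet measurable_const hε

lemma hilbertKernel_of_lt {ε t : ℝ} (h : ε < |t|) : hilbertKernel ε t = (t : ℂ)⁻¹ := by
  have h' : t ∈ outerSet ε := h
  simp [hilbertKernel, oscKernel, h']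

lemma hilbertKernel_of_le {ε t : ℝ} (h : |t| ≤ ε) : hilbertKernel ε t = 0 := by
  have h' : t ∉ outerSet ε := not_lt.2 h
  simp [hilbertKernel, oscKernel, h']

lemma hilbertKernel_neg (ε t : ℝ) : hilbertKernel ε (-t) = -hilbertKernel ε t := by
  rcases lt_or_ge ε |t| with h | h
  · rw [hilbertKernel_of_lt h, hilbertKernel_of_lt (by rwa [abs_neg])]
    push_cast
    rw [inv_neg]
  · rw [hilbertKernel_of_le h, hilbertKernel_of_le (by rwa [abs_neg]), neg_zero]

lemma monomialSum_empty (b : ℕ → ℝ) : monomialSum ∅ b = fun _ => 0 := by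
  ext t; simp [monomialSum]

/-- At each fixed frequency, the multiplier of an annulus of radius `R` is `O(R)`. -/
lemma norm_fourier_hilbert_annulus_le {ε R : ℝ} (hε : 0 < ε) (hR : ε ≤ R) (ξ : ℝ) :
    ‖𝓕 (oscKernel (fun _ => 0) (annulus ε R)) ξ‖ ≤ 2 * R * ‖2 * Real.pi * ξ‖ := by
  rw [fourier_oscKernel_annulus measurable_const hε hR]
  refine (intervalIntegral.norm_integral_le_of_norm_le_const (C := 2 * ‖2 * Real.pi * ξ‖)
    fun t ht => ?_).trans ?_
  · rw [Set.uIoc_of_le hR] at ht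
    have ht0 : 0 < t := hε.trans ht.1
    rw [norm_div, Complex.norm_real, Real.norm_eq_abs t, abs_of_pos ht0, div_le_iff₀ ht0]
    refine (norm_exp_sub_exp_le _ _).trans (le_of_eq ?_)
    rw [show (0 - 2 * Real.pi * ξ * t - (0 - 2 * Real.pi * ξ * -t)) =
      -(2 * (2 * Real.pi * ξ) * t) by ring, abs_neg, abs_mul, abs_mul, abs_of_pos ht0,
      Real.norm_eq_abs, abs_two]
  · rw [abs_of_nonneg (by linarith)]
    have : 0 ≤ ‖2 * Real.pi * ξ‖ := norm_nonneg _
    nlinarith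

/-- On Schwartz functions, the part of the Hilbert transform over an annulus of radius `R`
is `O(R)`. -/
lemma eLpNorm_cconv_hilbert_annulus_schwartz_le {ε R : ℝ} (hε : 0 < ε) (hR : ε ≤ R)
    (φ : 𝓢(ℝ, ℂ)) :
    eLpNorm (cconv (oscKernel (fun _ => 0) (annulus ε R)) φ) 2 ≤
      ENNReal.ofReal (2 * R) * eLpNorm (SchwartzMap.derivCLM ℂ ℂ φ) 2 := by
  have hd : 𝓕 (SchwartzMap.derivCLM ℂ ℂ φ : ℝ → ℂ) =
      fun x : ℝ => (2 * Real.pi * Complex.I * x : ℂ) • 𝓕 (φ : ℝ → ℂ) x :=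
    Real.fourier_deriv φ.integrable φ.differentiable (SchwartzMap.derivCLM ℂ ℂ φ).integrable
  have hR0 : 0 ≤ 2 * R := by linarith
  refine (eLpNorm_cconv_schwartz_le (integrable_oscKernel_annulus measurable_const hε R)
    (memLp_oscKernel_annulus measurable_const hε R) φ
    (h := ((2 * R : ℝ) : ℂ) • 𝓕 (SchwartzMap.derivCLM ℂ ℂ φ : ℝ → ℂ))
    ((memLp_fourier_schwartz _).const_smul _) fun ξ => ?_).trans (le_of_eq ?_)
  · rw [Pi.smul_apply, hd, norm_smul, norm_smul, norm_mul, ← mul_assoc]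
    refine mul_le_mul_of_nonneg_right
      ((norm_fourier_hilbert_annulus_le hε hR ξ).trans (le_of_eq ?_)) (norm_nonneg _)
    rw [Complex.norm_real, Real.norm_of_nonneg hR0]
    simp
  · rw [eLpNorm_const_smul, eLpNorm_fourier_schwartz]
    congr 1
    rw [← ofReal_norm, Complex.norm_real, Real.norm_of_nonneg hR0]

lemma memLp_cconv_hilbertKernel {ε : ℝ} (hε : 0 < ε) {f : ℝ → ℂ} (hf : MemLp f 2) :
    MemLp (cconv (hilbertKernel ε) f) 2 := by
  refine ⟨aestronglyMeasurable_cconv (memLp_hilbertKernel hε) hf, ?_⟩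
  have h := eLpNorm_cconv_outerSet_le (s := ∅) (by simp) 0 hε hf
  rw [monomialSum_empty] at h
  exact h.trans_lt (ENNReal.mul_lt_top ENNReal.coe_lt_top hf.eLpNorm_lt_top)

/-- The Cauchy criterion for the truncated Hilbert transforms of an `L²` function: the contribution
of an annulus of small radius is small in `L²`. -/
lemma exists_eLpNorm_cconv_hilbert_annulus_le {f : ℝ → ℂ} (hf : MemLp f 2) {η : ℝ≥0∞}
    (hη : 0 < η) : ∃ R₀ > 0, ∀ ε R, 0 < ε → ε ≤ R → R ≤ R₀ →
      eLpNorm (cconv (oscKernel (fun _ => 0) (annulus ε R)) f) 2 < η := by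
  set C : ℝ≥0∞ := ((phaseBound 1).toNNReal : ℝ≥0∞) with hC
  obtain ⟨φ, hφ⟩ := exists_schwartz_tendsto hf
  have hη2 : 0 < η / 2 := ENNReal.half_pos hη.ne'
  have h1 : Tendsto (fun n => C * eLpNorm (⇑(φ n) - f) 2) atTop (𝓝 0) := by
    simpa using ENNReal.Tendsto.const_mul hφ (.inr ENNReal.coe_ne_top)
  obtain ⟨n, hn⟩ := (h1.eventually_lt_const hη2).exists
  have h2 : Tendsto (fun R => ENNReal.ofReal (2 * R) *
      eLpNorm (SchwartzMap.derivCLM ℂ ℂ (φ n)) 2) (𝓝[>] 0) (𝓝 0) := by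
    have h3 : Tendsto (fun R : ℝ => ENNReal.ofReal (2 * R)) (𝓝[>] 0) (𝓝 0) := by
      have : Continuous fun R : ℝ => ENNReal.ofReal (2 * R) :=
        ENNReal.continuous_ofReal.comp (continuous_const_mul 2)
      simpa using (this.tendsto 0).mono_left nhdsWithin_le_nhds
    simpa using ENNReal.Tendsto.mul_const h3
      (.inr ((SchwartzMap.derivCLM ℂ ℂ (φ n)).memLp 2 volume).eLpNorm_ne_top)
  obtain ⟨R₀, hR₀, hlt⟩ := ((h2.eventually_lt_const hη2).and self_mem_nhdsWithin).exists
  refine ⟨R₀, hlt, fun ε R hε hεR hR => ?_⟩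
  have hk := memLp_oscKernel_annulus (Q := fun _ => 0) measurable_const hε R
  have hφ2 := (φ n).memLp 2 volume
  have hsplit : cconv (oscKernel (fun _ => 0) (annulus ε R)) f =
      cconv (oscKernel (fun _ => 0) (annulus ε R)) (φ n) -
      cconv (oscKernel (fun _ => 0) (annulus ε R)) (⇑(φ n) - f) := by
    ext x
    rw [Pi.sub_apply, cconv_sub_right hk hφ2 hf, sub_sub_cancel]
  rw [hsplit]
  refine (eLpNorm_sub_le (aestronglyMeasurable_cconv hk hφ2)
    (aestronglyMeasurable_cconv hk (hφ2.sub hf)) (by norm_num)).trans_lt ?_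
  rw [← ENNReal.add_halves η]
  refine ENNReal.add_lt_add ?_ ?_
  · refine ((eLpNorm_cconv_hilbert_annulus_schwartz_le hε hεR (φ n)).trans ?_).trans_lt hR₀
    gcongr
  · have h := eLpNorm_cconv_annulus_le (s := ∅) (by simp) 0 hε hεR (hφ2.sub hf)
    rw [monomialSum_empty] at h
    exact h.trans_lt hn

/-- The `L²` limit of the truncated Hilbert transforms of an `L²` function. -/
lemma exists_tendsto_eLpNorm_hilbert {f : ℝ → ℂ} (hf : MemLp f 2) :
    ∃ G : ℝ → ℂ, MemLp G 2 ∧ Tendsto (fun n : ℕ =>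
      eLpNorm (cconv (hilbertKernel (1 / (n + 1))) f - G) 2) atTop (𝓝 0) := by
  have hpos : ∀ n : ℕ, (0 : ℝ) < 1 / (n + 1) := fun n => Nat.one_div_pos_of_nat
  have hmem := fun n => memLp_cconv_hilbertKernel (hpos n) hf
  have hcau : CauchySeq fun n => (hmem n).toLp _ := by
    rw [EMetric.cauchySeq_iff']
    intro η hη
    obtain ⟨R₀, hR₀, h⟩ := exists_eLpNorm_cconv_hilbert_annulus_le hf hη
    obtain ⟨N, hN⟩ := exists_nat_one_div_lt hR₀
    refine ⟨N, fun n hn => ?_⟩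
    have hle : 1 / ((n : ℝ) + 1) ≤ 1 / (N + 1) := Nat.one_div_le_one_div hn
    rw [Lp.edist_toLp_toLp]
    convert! h _ _ (hpos n) hle hN.le using 2
    ext x
    rw [Pi.sub_apply, ← oscKernel_outerSet_sub hle]
    exact (cconv_sub_left (memLp_hilbertKernel (hpos n)) (memLp_hilbertKernel (hpos N)) hf x).symm
  obtain ⟨G, hG⟩ := cauchySeq_tendsto_of_complete hcau
  refine ⟨G, Lp.memLp G, ?_⟩
  rw [tendsto_iff_edist_tendsto_0] at hG
  refine hG.congr fun n => ?_
  rw [Lp.edist_def]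
  refine eLpNorm_congr_ae ?_
  filter_upwards [(hmem n).coeFn_toLp] with x hx
  rw [Pi.sub_apply, Pi.sub_apply, hx]

/-! ### Comparison with a mollification -/

/-- The tent function of integral `1` supported in `[-δ, δ]`. -/
noncomputable def tent (δ y : ℝ) : ℝ :=
  max (δ - |y|) 0 / δ ^ 2

@[fun_prop]
lemma continuous_tent (δ : ℝ) : Continuous (tent δ) := by
  unfold tent; fun_prop

lemma tent_nonneg (δ y : ℝ) : 0 ≤ tent δ y := by unfold tent; positivity

lemma tent_neg (δ y : ℝ) : tent δ (-y) = tent δ y := by simp [tent]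

lemma tent_of_le {δ y : ℝ} (h : δ ≤ |y|) : tent δ y = 0 := by
  rw [tent, max_eq_right (by linarith), zero_div]

lemma tent_le {δ : ℝ} (hδ : 0 < δ) (y : ℝ) : tent δ y ≤ δ⁻¹ := by
  rw [tent, div_le_iff₀ (by positivity)]
  have : δ⁻¹ * δ ^ 2 = δ := by field_simp
  rw [this]
  exact max_le (by linarith [abs_nonneg y]) hδ.le

lemma abs_tent_sub_le {δ : ℝ} (hδ : 0 < δ) (x y : ℝ) :
    |tent δ x - tent δ y| ≤ |x - y| / δ ^ 2 := by
  unfold tent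
  rw [← sub_div, abs_div, abs_of_pos (by positivity : 0 < δ ^ 2)]
  refine div_le_div_of_nonneg_right ?_ (by positivity)
  refine (abs_max_sub_max_le_abs (δ - |x|) (δ - |y|) 0).trans ?_
  rw [show δ - |x| - (δ - |y|) = -(|x| - |y|) by ring, abs_neg]
  exact abs_abs_sub_abs_le_abs_sub x y

lemma hasCompactSupport_tent (δ : ℝ) : HasCompactSupport (tent δ) :=
  HasCompactSupport.intro (isCompact_Icc (a := -δ) (b := δ)) fun y hy =>
    tent_of_le (by by_contra! h; exact hy (abs_le.1 h.le))

lemma integral_tent {δ : ℝ} (hδ : 0 < δ) : ∫ y, tent δ y = 1 := by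
  have h1 : ∫ y, tent δ y = 2 * ∫ y in Set.Ioi (0 : ℝ), max (δ - y) 0 / δ ^ 2 :=
    integral_comp_abs (f := fun y => max (δ - y) 0 / δ ^ 2)
  have h2 : ∫ y in Set.Ioi (0 : ℝ), max (δ - y) 0 / δ ^ 2 =
      ∫ y in Set.Ioc 0 δ, max (δ - y) 0 / δ ^ 2 := by
    refine setIntegral_eq_of_subset_of_forall_sdiff_eq_zero measurableSet_Ioi
      Set.Ioc_subset_Ioi_self fun y hy => ?_
    have : δ < y := by
      by_contra! h
      exact hy.2 ⟨hy.1, h⟩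
    rw [max_eq_right (by linarith), zero_div]
  have h3 : ∫ y in (0 : ℝ)..δ, max (δ - y) 0 / δ ^ 2 = ∫ y in (0 : ℝ)..δ, (δ - y) / δ ^ 2 := by
    refine intervalIntegral.integral_congr fun y hy => ?_
    rw [Set.uIcc_of_le hδ.le] at hy
    rw [max_eq_left (by linarith [hy.2])]
  rw [h1, h2, ← intervalIntegral.integral_of_le hδ.le, h3, intervalIntegral.integral_div,
    intervalIntegral.integral_sub (by simp) (by simp)]
  simp only [intervalIntegral.integral_const, integral_id, smul_eq_mul]
  field_simp
  ring

/-- The complex-valued tent function. -/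
noncomputable def ctent (δ : ℝ) : ℝ → ℂ := fun y => (tent δ y : ℂ)

lemma continuous_ctent (δ : ℝ) : Continuous (ctent δ) := by unfold ctent; fun_prop

lemma hasCompactSupport_ctent (δ : ℝ) : HasCompactSupport (ctent δ) :=
  (hasCompactSupport_tent δ).comp_left (g := fun x : ℝ => (x : ℂ)) (by simp)

lemma integrable_ctent (δ : ℝ) : Integrable (ctent δ) :=
  (continuous_ctent δ).integrable_of_hasCompactSupport (hasCompactSupport_ctent δ)

lemma memLp_ctent (δ : ℝ) : MemLp (ctent δ) 2 :=
  (continuous_ctent δ).memLp_of_hasCompactSupport (hasCompactSupport_ctent δ)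

lemma integral_ctent {δ : ℝ} (hδ : 0 < δ) : ∫ y, ctent δ y = 1 := by
  unfold ctent
  rw [integral_complex_ofReal, integral_tent hδ, Complex.ofReal_one]

/-- Associativity of the convolution of an integrable function with two `L²` functions. -/
lemma cconv_assoc {τ k f : ℝ → ℂ} (hτ : Integrable τ) (hτ2 : MemLp τ 2) (hk : MemLp k 2)
    (hf : MemLp f 2) (x : ℝ) : cconv (cconv τ k) f x = cconv τ (cconv k f) x := by
  unfold cconv
  refine convolution_assoc' (ContinuousLinearMap.mul ℂ ℂ) (ContinuousLinearMap.mul ℂ ℂ)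
    (ContinuousLinearMap.mul ℂ ℂ) (ContinuousLinearMap.mul ℂ ℂ) (fun a b c => by simp [mul_assoc])
    (Eventually.of_forall fun y => integrable_mul_comp_sub_left hτ2 hk y)
    (Eventually.of_forall fun y => integrable_mul_comp_sub_left hk hf y) ?_
  have hk' := (memLp_two_iff_integrable_sq_norm hk.1).1 hk
  have hfx := memLp_comp_sub_left hf x
  have hf' := (memLp_two_iff_integrable_sq_norm hfx.1).1 hfx
  have i1 : Integrable (fun p : ℝ × ℝ => ‖τ p.2‖ * ‖k (p.1 - p.2)‖ ^ 2)
      (volume.prod volume) :=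
    hτ.norm.convolution_integrand (ContinuousLinearMap.mul ℝ ℝ) hk'
  have i2 : Integrable (fun p : ℝ × ℝ => ‖f (x - p.1)‖ ^ 2 * ‖τ p.2‖) (volume.prod volume) :=
    hf'.mul_prod hτ.norm
  refine (i1.add i2).mono' ?_ (Eventually.of_forall fun p => ?_)
  · have m1 := hτ.1.convolution_integrand (ContinuousLinearMap.mul ℂ ℂ) (μ := volume) hk.1
    have m2 : AEStronglyMeasurable (fun p : ℝ × ℝ => f (x - p.1)) (volume.prod volume) :=
      hfx.1.comp_fst
    refine (m1.mul m2).congr (Eventually.of_forall fun p => ?_)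
    simp [Function.uncurry, mul_assoc]
  · simp only [Function.uncurry, ContinuousLinearMap.mul_apply', norm_mul, Pi.add_apply]
    nlinarith [norm_nonneg (τ p.2), norm_nonneg (k (p.1 - p.2)), norm_nonneg (f (x - p.1)),
      mul_nonneg (norm_nonneg (τ p.2)) (sq_nonneg (‖k (p.1 - p.2)‖ - ‖f (x - p.1)‖)),
      mul_nonneg (norm_nonneg (τ p.2)) (sq_nonneg (‖k (p.1 - p.2)‖ + ‖f (x - p.1)‖))]

/-- The difference between the Hilbert kernel truncated at `δ` and the mollification at scale `δ`
of the Hilbert kernel truncated at `ε`. -/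
noncomputable def kernelError (δ ε : ℝ) : ℝ → ℂ :=
  hilbertKernel δ - cconv (ctent δ) (hilbertKernel ε)

lemma cconv_comm (k f : ℝ → ℂ) (x : ℝ) : cconv k f x = cconv f k x := by
  rw [cconv_apply, cconv, convolution_mul_swap]
  simp only [mul_comm]

lemma norm_hilbertKernel_le {δ : ℝ} (hδ : 0 < δ) (t : ℝ) : ‖hilbertKernel δ t‖ ≤ δ⁻¹ := by
  rcases lt_or_ge δ |t| with h | h
  · rw [hilbertKernel_of_lt h, norm_inv, Complex.norm_real, Real.norm_eq_abs]
    exact inv_anti₀ hδ h.le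
  · rw [hilbertKernel_of_le h, norm_zero]; positivity

/-- Near the origin the mollified kernel is `O(1 / δ)`: folding the integral turns the singularity
`1 / s` into a difference quotient of the tent function. -/
lemma norm_cconv_ctent_hilbertKernel_le {δ ε t : ℝ} (hε : 0 < ε) (hεδ : ε ≤ δ)
    (ht : |t| ≤ 2 * δ) : ‖cconv (ctent δ) (hilbertKernel ε) t‖ ≤ 6 * δ⁻¹ := by
  have hδ : 0 < δ := hε.trans_le hεδ
  have hε3 : ε ≤ 3 * δ := by linarith
  have h1 : cconv (ctent δ) (hilbertKernel ε) t =
      ∫ s in annulus ε (3 * δ), (s : ℂ)⁻¹ * ctent δ (t - s) := by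
    rw [cconv_comm, cconv_apply, ← integral_indicator (measurableSet_annulus _ _)]
    congr 1 with s
    by_cases hs : s ∈ annulus ε (3 * δ)
    · rw [Set.indicator_of_mem hs, hilbertKernel_of_lt hs.1]
    · rw [Set.indicator_of_notMem hs]
      rcases lt_or_ge ε |s| with h | h
      · have h3 : 3 * δ < |s| := by by_contra! h3; exact hs ⟨h, h3⟩
        have : δ ≤ |t - s| := by
          have := abs_sub_abs_le_abs_sub s t
          rw [abs_sub_comm] at this
          linarith
        simp [ctent, tent_of_le this]
      · rw [hilbertKernel_of_le h, zero_mul]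
  have hint : IntegrableOn (fun s : ℝ => (s : ℂ)⁻¹ * ctent δ (t - s)) (annulus ε (3 * δ)) := by
    refine Measure.integrableOn_of_bounded (M := ε⁻¹ * δ⁻¹) ?_ ?_ ?_
    · exact ((measure_mono (annulus_subset_Icc ε _)).trans_lt (by simp [Real.volume_Icc])).ne
    · have := (continuous_ctent δ).measurable
      exact Measurable.aestronglyMeasurable (by fun_prop)
    · filter_upwards [ae_restrict_mem (measurableSet_annulus ε (3 * δ))] with s hs
      rw [norm_mul, norm_inv, Complex.norm_real, Real.norm_eq_abs, ctent, Complex.norm_real,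
        Real.norm_of_nonneg (tent_nonneg _ _)]
      exact mul_le_mul (inv_anti₀ hε hs.1.le) (tent_le hδ _) (tent_nonneg _ _) (by positivity)
  rw [h1, setIntegral_annulus hε hε3 hint]
  refine (intervalIntegral.norm_integral_le_of_norm_le_const (C := 2 / δ ^ 2)
    fun s hs => ?_).trans ?_
  · rw [Set.uIoc_of_le hε3] at hs
    have hs0 : 0 < s := hε.trans hs.1
    have h2 : (s : ℂ)⁻¹ * ctent δ (t - s) + ((-s : ℝ) : ℂ)⁻¹ * ctent δ (t - -s) =
        ((s⁻¹ * (tent δ (t - s) - tent δ (t + s)) : ℝ) : ℂ) := by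
      simp only [ctent, sub_neg_eq_add]
      push_cast
      rw [inv_neg]
      ring
    rw [h2, Complex.norm_real, norm_mul, norm_inv, Real.norm_of_nonneg hs0.le, Real.norm_eq_abs,
      inv_mul_le_iff₀ hs0]
    refine (abs_tent_sub_le hδ _ _).trans (le_of_eq ?_)
    rw [show t - s - (t + s) = -(2 * s) by ring, abs_neg, abs_of_pos (by linarith)]
    ring
  · rw [abs_of_nonneg (by linarith)]
    calc 2 / δ ^ 2 * (3 * δ - ε) ≤ 2 / δ ^ 2 * (3 * δ) := by gcongr; linarith
      _ = 6 * δ⁻¹ := by field_simp; norm_num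

/-- Away from the origin the error kernel is the mean of `1 / t - 1 / (t - y)` over `|y| ≤ δ`, which
is `O(δ / t²)`. -/
lemma norm_kernelError_le_of_far {δ ε t : ℝ} (hε : 0 < ε) (hεδ : ε ≤ δ)
    (ht : 2 * δ < |t|) : ‖kernelError δ ε t‖ ≤ 2 * δ / t ^ 2 := by
  have hδ : 0 < δ := hε.trans_le hεδ
  have ht0 : (t : ℂ) ≠ 0 := by
    rintro h
    rw [Complex.ofReal_eq_zero] at h
    rw [h, abs_zero] at ht; linarith
  have h1 : kernelError δ ε t =
      ∫ y, (ctent δ y * (t : ℂ)⁻¹ - ctent δ y * hilbertKernel ε (t - y)) := by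
    rw [integral_sub ((integrable_ctent δ).mul_const _)
      (integrable_mul_comp_sub_left (memLp_ctent δ) (memLp_hilbertKernel hε) t),
      integral_mul_const, integral_ctent hδ, one_mul, ← cconv_apply, kernelError, Pi.sub_apply,
      hilbertKernel_of_lt (by linarith)]
  have hint : Integrable (fun y => tent δ y * (2 * δ / t ^ 2)) :=
    ((continuous_tent δ).integrable_of_hasCompactSupport (hasCompactSupport_tent δ)).mul_const _
  rw [h1]
  refine (norm_integral_le_of_norm_le hint (Eventually.of_forall fun y => ?_)).trans (le_of_eq ?_)
  · rcases lt_or_ge |y| δ with hy | hy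
    · have h2 : |t| / 2 ≤ |t - y| := by
        have := abs_sub_abs_le_abs_sub t y
        linarith
      have h3 : ε < |t - y| := by linarith
      have h4 : ((t - y : ℝ) : ℂ) ≠ 0 := by
        rw [Ne, Complex.ofReal_eq_zero, ← abs_eq_zero]
        linarith
      have h5 : (t : ℂ)⁻¹ - ((t - y : ℝ) : ℂ)⁻¹ = ((-y / (t * (t - y)) : ℝ) : ℂ) := by
        push_cast at h4 ⊢
        field_simp
        ring
      rw [hilbertKernel_of_lt h3, ← mul_sub, norm_mul, h5, Complex.norm_real, ctent,
        Complex.norm_real, Real.norm_of_nonneg (tent_nonneg _ _)]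
      refine mul_le_mul_of_nonneg_left ?_ (tent_nonneg _ _)
      have ht' : 0 < |t| := by linarith
      rw [norm_div, norm_neg, norm_mul, Real.norm_eq_abs, Real.norm_eq_abs, Real.norm_eq_abs,
        div_le_div_iff₀ (by apply mul_pos <;> linarith) (by rw [← sq_abs]; positivity), ← sq_abs t]
      calc |y| * |t| ^ 2 ≤ δ * |t| ^ 2 := by gcongr
        _ = 2 * δ * (|t| * (|t| / 2)) := by ring
        _ ≤ 2 * δ * (|t| * |t - y|) := by gcongr
    · simp [ctent, tent_of_le hy]
  · rw [integral_mul_const, integral_tent hδ, one_mul]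

/-- The error kernel is dominated by a multiple of the Poisson kernel at scale `δ`, uniformly
in `ε ≤ δ`. -/
lemma norm_kernelError_le {δ ε : ℝ} (hε : 0 < ε) (hεδ : ε ≤ δ) (t : ℝ) :
    ‖kernelError δ ε t‖ ≤ 35 * (δ / (δ ^ 2 + t ^ 2)) := by
  have hδ : 0 < δ := hε.trans_le hεδ
  rcases le_or_gt |t| (2 * δ) with ht | ht
  · have h1 : ‖kernelError δ ε t‖ ≤ 7 * δ⁻¹ := by
      refine (norm_sub_le _ _).trans ?_
      have := norm_hilbertKernel_le hδ t
      have := norm_cconv_ctent_hilbertKernel_le hε hεδ ht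
      linarith
    refine h1.trans ?_
    have : t ^ 2 ≤ (2 * δ) ^ 2 := by rw [← sq_abs]; gcongr
    rw [mul_div_assoc', ← div_eq_mul_inv, div_le_div_iff₀ hδ (by positivity)]
    nlinarith
  · refine (norm_kernelError_le_of_far hε hεδ ht).trans ?_
    have : (2 * δ) ^ 2 < t ^ 2 := by rw [← sq_abs t]; gcongr
    have ht2 : 0 < t ^ 2 := lt_of_le_of_lt (by positivity) this
    rw [mul_div_assoc', div_le_div_iff₀ ht2 (by positivity)]
    nlinarith

lemma kernelError_neg (δ ε t : ℝ) : kernelError δ ε (-t) = -kernelError δ ε t := by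
  have h : cconv (ctent δ) (hilbertKernel ε) (-t) = -cconv (ctent δ) (hilbertKernel ε) t := by
    rw [cconv_apply, cconv_apply, ← integral_neg_eq_self, ← integral_neg]
    congr 1 with y
    rw [show -t - -y = -(t - y) by ring, hilbertKernel_neg, mul_neg]
    simp only [ctent, tent_neg]
  simp only [kernelError, Pi.sub_apply, hilbertKernel_neg, h]
  ring

lemma integral_kernelError (δ ε : ℝ) : ∫ t, kernelError δ ε t = 0 := by
  have h : ∫ t, kernelError δ ε (-t) = ∫ t, kernelError δ ε t := integral_neg_eq_self _ _
  simp only [kernelError_neg, integral_neg] at h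
  exact CharZero.neg_eq_self_iff.1 h

lemma integrable_poisson {δ : ℝ} (hδ : 0 < δ) : Integrable (fun t : ℝ => δ / (δ ^ 2 + t ^ 2)) := by
  have h := (integrable_inv_one_add_sq.comp_div hδ.ne').const_mul δ⁻¹
  refine h.congr (Eventually.of_forall fun t => ?_)
  simp only
  field_simp

lemma measurable_hilbertKernel (ε : ℝ) : Measurable (hilbertKernel ε) :=
  measurable_oscKernel measurable_const (measurableSet_outerSet ε)

lemma aestronglyMeasurable_kernelError (δ : ℝ) {ε : ℝ} (hε : 0 < ε) :
    AEStronglyMeasurable (kernelError δ ε) :=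
  (measurable_hilbertKernel δ).aestronglyMeasurable.sub
    (aestronglyMeasurable_cconv (memLp_ctent δ) (memLp_hilbertKernel hε))

lemma integrable_kernelError {δ ε : ℝ} (hε : 0 < ε) (hεδ : ε ≤ δ) :
    Integrable (kernelError δ ε) :=
  ((integrable_poisson (hε.trans_le hεδ)).const_mul 35).mono'
    (aestronglyMeasurable_kernelError δ hε)
    (Eventually.of_forall fun t => norm_kernelError_le hε hεδ t)

lemma memLp_kernelError {δ ε : ℝ} (hε : 0 < ε) (hεδ : ε ≤ δ) : MemLp (kernelError δ ε) 2 := by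
  have hδ : 0 < δ := hε.trans_le hεδ
  have hm := aestronglyMeasurable_kernelError δ hε
  rw [memLp_two_iff_integrable_sq_norm hm]
  refine ((integrable_kernelError hε hεδ).norm.const_mul (35 * δ⁻¹)).mono'
    (hm.norm.pow 2) (Eventually.of_forall fun t => ?_)
  have h : ‖kernelError δ ε t‖ ≤ 35 * δ⁻¹ := by
    refine (norm_kernelError_le hε hεδ t).trans ?_
    gcongr
    rw [← one_div, div_le_div_iff₀ (by positivity) hδ]
    nlinarith [sq_nonneg t]
  rw [Real.norm_of_nonneg (by positivity), sq]
  gcongr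

/-- The comparison between the truncated Hilbert transform and a mollification at the same scale.
The error kernel is odd, so that only the oscillation of `f` at `x` matters. -/
lemma enorm_cconv_hilbert_sub_le {δ ε : ℝ} (hε : 0 < ε) (hεδ : ε ≤ δ) {f : ℝ → ℂ}
    (hf : MemLp f 2) (x : ℝ) :
    ‖cconv (hilbertKernel δ) f x - cconv (ctent δ) (cconv (hilbertKernel ε) f) x‖ₑ ≤
      35 * ∫⁻ t, ENNReal.ofReal (δ / (δ ^ 2 + t ^ 2)) * ‖f (x - t) - f x‖ₑ := by
  have hδ : 0 < δ := hε.trans_le hεδ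
  have hw := memLp_kernelError hε hεδ
  have hτk : MemLp (cconv (ctent δ) (hilbertKernel ε)) 2 := by
    have := (memLp_hilbertKernel hδ).sub hw
    rwa [kernelError, sub_sub_cancel] at this
  have h1 : cconv (hilbertKernel δ) f x - cconv (ctent δ) (cconv (hilbertKernel ε) f) x =
      ∫ t, kernelError δ ε t * (f (x - t) - f x) := by
    rw [← cconv_assoc (integrable_ctent δ) (memLp_ctent δ) (memLp_hilbertKernel hε) hf,
      ← cconv_sub_left (memLp_hilbertKernel hδ) hτk hf]
    simp only [mul_sub]
    rw [integral_sub (integrable_mul_comp_sub_left hw hf x)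
      ((integrable_kernelError hε hεδ).mul_const _), integral_mul_const, integral_kernelError,
      zero_mul, sub_zero, cconv_apply]
    rfl
  rw [h1, ← lintegral_const_mul' _ _ (by norm_num)]
  refine (enorm_integral_le_lintegral_enorm _).trans (lintegral_mono fun t => ?_)
  rw [enorm_mul, ← mul_assoc]
  gcongr
  rw [← ofReal_norm, show (35 : ℝ≥0∞) = ENNReal.ofReal 35 by simp,
    ← ENNReal.ofReal_mul (by norm_num)]
  exact ENNReal.ofReal_le_ofReal (norm_kernelError_le hε hεδ t)

/-! ### Lebesgue points and almost everywhere convergence -/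

/-- The mean oscillation of `f` around its value at `x` over the interval of radius `r`, up to a
factor `2`. -/
noncomputable def oscAvg (f : ℝ → ℂ) (x r : ℝ) : ℝ≥0∞ :=
  (∫⁻ t in Set.Icc (-r) r, ‖f (x - t) - f x‖ₑ) / ENNReal.ofReal r

/-- The reflection `t ↦ x - t` turns integrals over `[-r, r]` into integrals over the closed ball
of radius `r` around `x`. -/
lemma setLIntegral_comp_sub_left (g : ℝ → ℝ≥0∞) (x r : ℝ) :
    ∫⁻ t in Set.Icc (-r) r, g (x - t) = ∫⁻ y in Metric.closedBall x r, g y := by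
  rw [← lintegral_indicator measurableSet_Icc,
    ← lintegral_indicator Metric.isClosed_closedBall.measurableSet,
    ← lintegral_sub_left_eq_self ((Metric.closedBall x r).indicator g) x]
  congr 1 with t
  have h : x - t ∈ Metric.closedBall x r ↔ t ∈ Set.Icc (-r) r := by
    rw [Metric.mem_closedBall, Real.dist_eq, sub_sub_cancel_left, abs_neg, abs_le, Set.mem_Icc]
  by_cases ht : t ∈ Set.Icc (-r) r
  · rw [Set.indicator_of_mem ht, Set.indicator_of_mem (h.2 ht)]
  · rw [Set.indicator_of_notMem ht, Set.indicator_of_notMem (mt h.1 ht)]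

/-- Lebesgue's differentiation theorem. -/
lemma ae_tendsto_oscAvg {f : ℝ → ℂ} (hf : MemLp f 2) :
    ∀ᵐ x, Tendsto (oscAvg f x) (𝓝[>] 0) (𝓝 0) := by
  have hloc : LocallyIntegrable f := hf.locallyIntegrable (by norm_num)
  filter_upwards [(Besicovitch.vitaliFamily volume).ae_tendsto_lintegral_enorm_sub_div hloc]
    with x hx
  have h1 := hx.comp (Besicovitch.tendsto_filterAt volume x)
  have h2 := ENNReal.Tendsto.const_mul (a := 2) h1 (.inr (by norm_num))
  rw [mul_zero] at h2
  refine h2.congr' ?_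
  filter_upwards [self_mem_nhdsWithin] with r hr
  have hr0 : (0 : ℝ) < r := hr
  simp only [Function.comp_apply, oscAvg]
  rw [setLIntegral_comp_sub_left (fun y => ‖f y - f x‖ₑ), Real.volume_closedBall,
    ENNReal.ofReal_mul (by norm_num), ENNReal.ofReal_ofNat, mul_comm, ENNReal.div_eq_inv_mul,
    ENNReal.mul_inv (by simp) (by simp), ENNReal.div_eq_inv_mul, mul_comm, ← mul_assoc, ← mul_assoc,
    ENNReal.mul_inv_cancel (by norm_num) (by norm_num), one_mul]

/-- At a Lebesgue point the mean oscillations are bounded over all scales. At large scales this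
uses that `f` is square-integrable. -/
lemma exists_oscAvg_le {f : ℝ → ℂ} (hf : MemLp f 2) {x : ℝ}
    (hx : Tendsto (oscAvg f x) (𝓝[>] 0) (𝓝 0)) :
    ∃ M : ℝ≥0∞, M ≠ ∞ ∧ ∀ r, 0 < r → oscAvg f x r ≤ M := by
  have h1 : ∀ᶠ r in 𝓝[>] (0 : ℝ), oscAvg f x r < 1 := hx.eventually_lt_const one_pos
  obtain ⟨r₀, hr₀, h2⟩ := (mem_nhdsGT_iff_exists_Ioo_subset).1 h1
  have hr₀' : 0 < r₀ := hr₀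
  set S : ℝ≥0∞ := ∫⁻ t, ‖f t‖ₑ ^ 2 with hS
  have hSfin : S ≠ ∞ := by
    have h3 : eLpNorm f 2 ^ (2 : ℝ) = S := by
      simpa using eLpNorm_nnreal_pow_eq_lintegral (f := f) (μ := volume) (p := 2) (by norm_num)
    rw [← h3]
    exact ENNReal.rpow_ne_top_of_nonneg (by norm_num) hf.eLpNorm_ne_top
  have hle : ∀ r, r₀ ≤ r → oscAvg f x r ≤ 2 + 2 * ‖f x‖ₑ + S / ENNReal.ofReal r₀ := by
    intro r hr
    have hr0 : 0 < r := hr₀'.trans_le hr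
    have h3 : ∀ a b : ℂ, ‖a - b‖ₑ ≤ (1 + ‖b‖ₑ) + ‖a‖ₑ ^ 2 := by
      intro a b
      have h4 : ‖a‖ₑ ≤ 1 + ‖a‖ₑ ^ 2 := by
        rcases le_total ‖a‖ₑ 1 with h | h
        · exact h.trans le_self_add
        · calc ‖a‖ₑ ≤ ‖a‖ₑ * ‖a‖ₑ := le_mul_of_one_le_right' h
            _ ≤ 1 + ‖a‖ₑ ^ 2 := by rw [sq]; exact le_add_self
      calc ‖a - b‖ₑ ≤ ‖a‖ₑ + ‖b‖ₑ := enorm_sub_le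
        _ ≤ (1 + ‖a‖ₑ ^ 2) + ‖b‖ₑ := by gcongr
        _ = _ := by ring
    have h5 : ∫⁻ t in Set.Icc (-r) r, ‖f (x - t) - f x‖ₑ ≤
        (1 + ‖f x‖ₑ) * (2 * ENNReal.ofReal r) + S := by
      calc _ ≤ ∫⁻ t in Set.Icc (-r) r, ((1 + ‖f x‖ₑ) + ‖f (x - t)‖ₑ ^ 2) :=
            lintegral_mono fun t => h3 _ _
        _ = (1 + ‖f x‖ₑ) * (2 * ENNReal.ofReal r) +
            ∫⁻ t in Set.Icc (-r) r, ‖f (x - t)‖ₑ ^ 2 := by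
            rw [lintegral_add_left measurable_const, setLIntegral_const, Real.volume_Icc,
              sub_neg_eq_add, ← two_mul, ENNReal.ofReal_mul (by norm_num), ENNReal.ofReal_ofNat]
        _ ≤ _ := by
            gcongr
            refine (setLIntegral_le_lintegral _ _).trans ?_
            rw [lintegral_sub_left_eq_self (fun t => ‖f t‖ₑ ^ 2) x]
    have hr1 : ENNReal.ofReal r ≠ 0 := by simpa using hr0
    rw [oscAvg]
    calc _ ≤ ((1 + ‖f x‖ₑ) * (2 * ENNReal.ofReal r) + S) / ENNReal.ofReal r := by gcongr
      _ = 2 + 2 * ‖f x‖ₑ + S / ENNReal.ofReal r := by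
          rw [ENNReal.add_div, ← mul_assoc, ENNReal.mul_div_cancel_right hr1 (by simp)]
          ring
      _ ≤ _ := by gcongr
  refine ⟨1 + (2 + 2 * ‖f x‖ₑ + S / ENNReal.ofReal r₀), ?_, fun r hr => ?_⟩
  · have h6 : S / ENNReal.ofReal r₀ ≠ ∞ := ENNReal.div_ne_top hSfin (by simpa using hr₀')
    have h7 : 2 * ‖f x‖ₑ ≠ ∞ := ENNReal.mul_ne_top (by norm_num) enorm_ne_top
    simp [h6, h7]
  · rcases lt_or_ge r r₀ with h | h
    · exact (h2 ⟨hr, h⟩ : oscAvg f x r < 1).le.trans le_self_add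
    · exact (hle r h).trans le_add_self

/-- The Poisson kernel at scale `δ` is dominated by a sum of normalized indicator functions of the
intervals of radii `2 ^ j δ`, with geometrically decaying coefficients. -/
lemma ofReal_poisson_le_tsum {δ : ℝ} (hδ : 0 < δ) (t : ℝ) :
    ENNReal.ofReal (δ / (δ ^ 2 + t ^ 2)) ≤ ∑' j : ℕ,
      (Set.Icc (-(2 ^ j * δ)) (2 ^ j * δ)).indicator
        (fun _ => ENNReal.ofReal (4 / (4 ^ j * δ))) t := by
  obtain ⟨j, hj, hle⟩ : ∃ j : ℕ, |t| ≤ 2 ^ j * δ ∧ δ / (δ ^ 2 + t ^ 2) ≤ 4 / (4 ^ j * δ) := by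
    rcases le_or_gt |t| δ with h | h
    · refine ⟨0, by simpa using h, ?_⟩
      rw [div_le_div_iff₀ (by positivity) (by positivity)]
      nlinarith [sq_nonneg t]
    · obtain ⟨n, h1, h2⟩ := exists_nat_pow_near ((one_le_div hδ).2 h.le) one_lt_two
      rw [le_div_iff₀ hδ] at h1
      rw [div_lt_iff₀ hδ] at h2
      refine ⟨n + 1, h2.le, ?_⟩
      have h3 : 4 ^ n * δ ^ 2 ≤ t ^ 2 := by
        rw [← sq_abs t]
        calc (4 : ℝ) ^ n * δ ^ 2 = (2 ^ n * δ) ^ 2 := by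
              rw [mul_pow, ← pow_mul, mul_comm n, pow_mul]; norm_num
          _ ≤ _ := by gcongr
      rw [div_le_div_iff₀ (by positivity) (by positivity), pow_succ]
      nlinarith [sq_nonneg δ]
  refine le_trans ?_ (ENNReal.le_tsum j)
  rw [Set.indicator_of_mem (Set.mem_Icc.2 (abs_le.1 hj))]
  exact ENNReal.ofReal_le_ofReal hle

lemma lintegral_poisson_mul_le {δ : ℝ} (hδ : 0 < δ) {f : ℝ → ℂ} (hf : MemLp f 2) (x : ℝ) :
    ∫⁻ t, ENNReal.ofReal (δ / (δ ^ 2 + t ^ 2)) * ‖f (x - t) - f x‖ₑ ≤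
      ∑' j : ℕ, ENNReal.ofReal (4 * (1 / 2) ^ j) * oscAvg f x (2 ^ j * δ) := by
  have hm : AEMeasurable (fun t => ‖f (x - t) - f x‖ₑ) :=
    ((memLp_comp_sub_left hf x).1.sub aestronglyMeasurable_const).enorm
  calc _ ≤ ∫⁻ t, ∑' j : ℕ, (Set.Icc (-(2 ^ j * δ)) (2 ^ j * δ)).indicator
        (fun _ => ENNReal.ofReal (4 / (4 ^ j * δ))) t * ‖f (x - t) - f x‖ₑ := by
        refine lintegral_mono fun t => ?_
        rw [ENNReal.tsum_mul_right]
        gcongr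
        exact ofReal_poisson_le_tsum hδ t
    _ = ∑' j : ℕ, ∫⁻ t, (Set.Icc (-(2 ^ j * δ)) (2 ^ j * δ)).indicator
        (fun _ => ENNReal.ofReal (4 / (4 ^ j * δ))) t * ‖f (x - t) - f x‖ₑ :=
        lintegral_tsum fun j =>
          ((measurable_const.indicator measurableSet_Icc).aemeasurable).mul hm
    _ = _ := by
        congr 1 with j
        have h1 : ∀ t, (Set.Icc (-(2 ^ j * δ)) (2 ^ j * δ)).indicator
            (fun _ => ENNReal.ofReal (4 / (4 ^ j * δ))) t * ‖f (x - t) - f x‖ₑ =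
            (Set.Icc (-(2 ^ j * δ)) (2 ^ j * δ)).indicator
            (fun t => ENNReal.ofReal (4 / (4 ^ j * δ)) * ‖f (x - t) - f x‖ₑ) t := by
          intro t
          by_cases ht : t ∈ Set.Icc (-(2 ^ j * δ)) (2 ^ j * δ) <;> simp [ht]
        simp only [h1]
        rw [lintegral_indicator measurableSet_Icc, lintegral_const_mul' _ _ (by simp), oscAvg,
          ENNReal.div_eq_inv_mul, ← mul_assoc, ← ENNReal.ofReal_inv_of_pos (by positivity),
          ← ENNReal.ofReal_mul (by positivity)]
        congr 2
        rw [show (4 : ℝ) ^ j = 2 ^ j * 2 ^ j by rw [← mul_pow]; norm_num, one_div, inv_pow]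
        field_simp

/-- At a Lebesgue point, the Poisson means of the oscillation of `f` tend to zero. -/
lemma tendsto_lintegral_poisson_mul {f : ℝ → ℂ} (hf : MemLp f 2) {x : ℝ}
    (hx : Tendsto (oscAvg f x) (𝓝[>] 0) (𝓝 0)) :
    Tendsto (fun δ => ∫⁻ t, ENNReal.ofReal (δ / (δ ^ 2 + t ^ 2)) * ‖f (x - t) - f x‖ₑ)
      (𝓝[>] 0) (𝓝 0) := by
  obtain ⟨M, hM, hle⟩ := exists_oscAvg_le hf hx
  have hsum : Tendsto (fun δ => ∫⁻ j : ℕ,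
      ENNReal.ofReal (4 * (1 / 2) ^ j) * oscAvg f x (2 ^ j * δ) ∂Measure.count)
      (𝓝[>] 0) (𝓝 (∫⁻ _ : ℕ, 0 ∂Measure.count)) := by
    refine tendsto_lintegral_filter_of_dominated_convergence
      (fun j => ENNReal.ofReal (4 * (1 / 2) ^ j) * M)
      (Eventually.of_forall fun δ => measurable_from_nat) ?_ ?_
      (Eventually.of_forall fun j => ?_)
    · filter_upwards [self_mem_nhdsWithin] with δ hδ
      refine Eventually.of_forall fun j => ?_
      have hδ' : (0 : ℝ) < δ := hδ
      gcongr
      exact hle _ (by positivity)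
    · rw [lintegral_count, ENNReal.tsum_mul_right]
      refine ENNReal.mul_ne_top ?_ hM
      have hs : Summable fun j : ℕ => (4 : ℝ) * (1 / 2) ^ j := summable_geometric_two.mul_left 4
      rw [← ENNReal.ofReal_tsum_of_nonneg (fun j => by positivity) hs]
      exact ENNReal.ofReal_ne_top
    · have h1 : Tendsto (fun δ : ℝ => 2 ^ j * δ) (𝓝[>] 0) (𝓝[>] 0) := by
        refine tendsto_nhdsWithin_iff.2 ⟨?_, ?_⟩
        · have : Continuous fun δ : ℝ => 2 ^ j * δ := by fun_prop
          simpa using (this.tendsto 0).mono_left nhdsWithin_le_nhds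
        · filter_upwards [self_mem_nhdsWithin] with δ hδ
          have hδ' : (0 : ℝ) < δ := hδ
          exact mul_pos (by positivity) hδ'
      simpa using ENNReal.Tendsto.const_mul (a := ENNReal.ofReal (4 * (1 / 2) ^ j)) (hx.comp h1)
        (.inr ENNReal.ofReal_ne_top)
  simp only [lintegral_count, tsum_zero] at hsum
  refine tendsto_of_tendsto_of_tendsto_of_le_of_le' tendsto_const_nhds hsum
    (Eventually.of_forall fun _ => zero_le) ?_
  filter_upwards [self_mem_nhdsWithin] with δ hδ
  exact lintegral_poisson_mul_le hδ hf x

/-- At a Lebesgue point, the means against the tent functions converge. -/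
lemma tendsto_cconv_ctent {G : ℝ → ℂ} (hG : MemLp G 2) {x : ℝ}
    (hx : Tendsto (oscAvg G x) (𝓝[>] 0) (𝓝 0)) :
    Tendsto (fun δ => cconv (ctent δ) G x) (𝓝[>] 0) (𝓝 (G x)) := by
  rw [tendsto_iff_edist_tendsto_0]
  refine tendsto_of_tendsto_of_tendsto_of_le_of_le' tendsto_const_nhds hx
    (Eventually.of_forall fun _ => zero_le) ?_
  filter_upwards [self_mem_nhdsWithin] with δ hδ
  have hδ0 : 0 < δ := hδ
  have h1 : cconv (ctent δ) G x - G x = ∫ y, ctent δ y * (G (x - y) - G x) := by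
    simp only [mul_sub]
    rw [integral_sub (integrable_mul_comp_sub_left (memLp_ctent δ) hG x)
      ((integrable_ctent δ).mul_const _), integral_mul_const, integral_ctent hδ0, one_mul,
      cconv_apply]
  rw [edist_eq_enorm_sub, h1, oscAvg, ENNReal.div_eq_inv_mul, ← ENNReal.ofReal_inv_of_pos hδ0,
    ← lintegral_const_mul' _ _ ENNReal.ofReal_ne_top, ← lintegral_indicator measurableSet_Icc]
  refine (enorm_integral_le_lintegral_enorm _).trans (lintegral_mono fun y => ?_)
  by_cases hy : y ∈ Set.Icc (-δ) δ
  · rw [Set.indicator_of_mem hy, enorm_mul]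
    gcongr
    rw [← ofReal_norm, ctent, Complex.norm_real, Real.norm_of_nonneg (tent_nonneg _ _)]
    exact ENNReal.ofReal_le_ofReal (tent_le hδ0 y)
  · have : δ ≤ |y| := by
      by_contra! h
      exact hy (abs_le.1 h.le)
    simp [ctent, tent_of_le this]

/-- The truncated Hilbert transforms of an `L²` function converge almost everywhere. -/
theorem ae_exists_tendsto_hilbert {f : ℝ → ℂ} (hf : MemLp f 2) :
    ∀ᵐ x, ∃ L, Tendsto (fun δ => cconv (hilbertKernel δ) f x) (𝓝[>] 0) (𝓝 L) := by
  obtain ⟨G, hG, hlim⟩ := exists_tendsto_eLpNorm_hilbert hf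
  filter_upwards [ae_tendsto_oscAvg hf, ae_tendsto_oscAvg hG] with x hx hxG
  refine ⟨G x, ?_⟩
  have hpos : ∀ n : ℕ, (0 : ℝ) < 1 / (n + 1) := fun n => Nat.one_div_pos_of_nat
  have key : ∀ δ, 0 < δ → ‖cconv (hilbertKernel δ) f x - cconv (ctent δ) G x‖ₑ ≤
      35 * ∫⁻ t, ENNReal.ofReal (δ / (δ ^ 2 + t ^ 2)) * ‖f (x - t) - f x‖ₑ := by
    intro δ hδ
    have h1 := tendsto_cconv_right (memLp_ctent δ)
      (fun n => memLp_cconv_hilbertKernel (hpos n) hf) hG hlim x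
    refine le_of_tendsto ((tendsto_const_nhds.sub h1).enorm) ?_
    obtain ⟨N, hN⟩ := exists_nat_one_div_lt hδ
    filter_upwards [eventually_ge_atTop N] with n hn
    exact enorm_cconv_hilbert_sub_le (hpos n) ((Nat.one_div_le_one_div hn).trans hN.le) hf x
  have h2 : Tendsto (fun δ => cconv (hilbertKernel δ) f x - cconv (ctent δ) G x) (𝓝[>] 0)
      (𝓝 0) := by
    rw [tendsto_zero_iff_enorm_tendsto_zero]
    have h3 := ENNReal.Tendsto.const_mul (a := 35) (tendsto_lintegral_poisson_mul hf hx)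
      (.inr (by norm_num))
    rw [mul_zero] at h3
    refine tendsto_of_tendsto_of_tendsto_of_le_of_le' tendsto_const_nhds h3
      (Eventually.of_forall fun _ => zero_le) ?_
    filter_upwards [self_mem_nhdsWithin] with δ hδ using key δ hδ
  simpa using h2.add (tendsto_cconv_ctent hG hxG)

/-! ### The oscillatory Hilbert transform -/

/-- The bounded part `(e^{iQ(t)} - 1) / t` of the kernel `e^{iQ(t)} / t`. -/
noncomputable def regularKernel (Q : ℝ → ℝ) (t : ℝ) : ℂ :=
  (Complex.exp (Complex.I * (Q t : ℂ)) - 1) / (t : ℂ)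

lemma norm_exp_sub_one_le_of_abs_le_one {s : Finset ℕ} (hs : 0 ∉ s) (b : ℕ → ℝ) {t : ℝ}
    (ht : |t| ≤ 1) :
    ‖Complex.exp (Complex.I * (monomialSum s b t : ℂ)) - 1‖ ≤ (∑ k ∈ s, |b k|) * |t| := by
  refine Real.norm_exp_I_mul_ofReal_sub_one_le.trans ?_
  rw [Real.norm_eq_abs, monomialSum, Finset.sum_mul]
  refine (Finset.abs_sum_le_sum_abs _ _).trans (Finset.sum_le_sum fun k hk => ?_)
  rw [abs_mul, abs_pow]
  gcongr
  exact pow_le_of_le_one (abs_nonneg t) ht fun h => hs (h ▸ hk)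

/-- Since the phase has no constant term, removing the singularity `1 / t` from the kernel leaves
a square-integrable function. -/
lemma memLp_regularKernel {s : Finset ℕ} (hs : 0 ∉ s) (b : ℕ → ℝ) :
    MemLp (regularKernel (monomialSum s b)) 2 := by
  have hQ := (continuous_monomialSum s b).measurable
  have hm : Measurable (regularKernel (monomialSum s b)) := by
    unfold regularKernel; fun_prop
  set B := ∑ k ∈ s, |b k| with hB
  have hB0 : 0 ≤ B := Finset.sum_nonneg fun k _ => abs_nonneg _
  rw [memLp_two_iff_integrable_sq_norm hm.aestronglyMeasurable]
  refine (integrable_inv_one_add_sq.const_mul (2 * B ^ 2 + 8)).mono'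
    (hm.norm.pow_const 2).aestronglyMeasurable (Eventually.of_forall fun t => ?_)
  rw [Real.norm_of_nonneg (by positivity), ← div_eq_mul_inv, le_div_iff₀ (by positivity)]
  unfold regularKernel
  rw [norm_div, Complex.norm_real, Real.norm_eq_abs]
  rcases le_or_gt |t| 1 with ht | ht
  · have h1 : ‖Complex.exp (Complex.I * (monomialSum s b t : ℂ)) - 1‖ / |t| ≤ B :=
      div_le_of_le_mul₀ (abs_nonneg t) hB0 (norm_exp_sub_one_le_of_abs_le_one hs b ht)
    have h2 : 1 + t ^ 2 ≤ 2 := by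
      have : |t| ^ 2 ≤ 1 := pow_le_one₀ (abs_nonneg t) ht
      rw [sq_abs] at this; linarith
    calc _ ≤ B ^ 2 * 2 := by gcongr
      _ ≤ _ := by linarith
  · have h1 : ‖Complex.exp (Complex.I * (monomialSum s b t : ℂ)) - 1‖ ≤ 2 := by
      refine (norm_sub_le _ _).trans ?_
      rw [Complex.norm_exp_I_mul_ofReal, norm_one]; norm_num
    have h2 : 1 + t ^ 2 ≤ 2 * |t| ^ 2 := by
      have : 1 ≤ |t| ^ 2 := one_le_pow₀ ht.le
      rw [← sq_abs t]; linarith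
    have h3 : 0 < |t| := by linarith
    calc _ ≤ (2 / |t|) ^ 2 * (2 * |t| ^ 2) := by gcongr
      _ = 8 := by field_simp; norm_num
      _ ≤ _ := by nlinarith

/-- Splitting off the truncated Hilbert transform leaves an absolutely convergent integral. -/
lemma cconv_oscKernel_eq {s : Finset ℕ} (hs : 0 ∉ s) (b : ℕ → ℝ) {ε : ℝ} (hε : 0 < ε) {f : ℝ → ℂ}
    (hf : MemLp f 2) (x : ℝ) :
    cconv (oscKernel (monomialSum s b) (outerSet ε)) f x = cconv (hilbertKernel ε) f x +
      ∫ t, (outerSet ε).indicator (fun t => regularKernel (monomialSum s b) t * f (x - t)) t := by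
  rw [cconv_apply, cconv_apply,
    ← integral_add (integrable_mul_comp_sub_left (memLp_hilbertKernel hε) hf x)
      ((integrable_mul_comp_sub_left (memLp_regularKernel hs b) hf x).indicator
        (measurableSet_outerSet ε))]
  congr 1 with t
  by_cases ht : t ∈ outerSet ε
  · simp only [oscKernel, hilbertKernel, regularKernel, Set.indicator_of_mem ht]
    simp
    ring
  · simp [oscKernel, hilbertKernel, ht]

/-- The truncated operators converge almost everywhere, by comparison with the Hilbert
transform. -/
lemma ae_exists_tendsto_cconv_oscKernel {s : Finset ℕ} (hs : 0 ∉ s) (b : ℕ → ℝ) {f : ℝ → ℂ}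
    (hf : MemLp f 2) : ∀ᵐ x, ∃ L, Tendsto
      (fun ε => cconv (oscKernel (monomialSum s b) (outerSet ε)) f x) (𝓝[>] 0) (𝓝 L) := by
  filter_upwards [ae_exists_tendsto_hilbert hf] with x ⟨L, hL⟩
  have hi := integrable_mul_comp_sub_left (memLp_regularKernel hs b) hf x
  have h2 : Tendsto (fun ε => ∫ t, (outerSet ε).indicator
      (fun t => regularKernel (monomialSum s b) t * f (x - t)) t) (𝓝[>] 0)
      (𝓝 (∫ t, regularKernel (monomialSum s b) t * f (x - t))) := by
    refine tendsto_integral_filter_of_dominated_convergence _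
      (Eventually.of_forall fun ε => (hi.indicator (measurableSet_outerSet ε)).1)
      (Eventually.of_forall fun ε => Eventually.of_forall fun t => norm_indicator_le_norm_self _ _)
      hi.norm ?_
    filter_upwards [Measure.ae_ne volume (0 : ℝ)] with t ht
    refine tendsto_const_nhds.congr' ?_
    filter_upwards [nhdsWithin_le_nhds (Iio_mem_nhds (abs_pos.2 ht))] with ε hε
    have : t ∈ outerSet ε := hε
    rw [Set.indicator_of_mem this]
  refine ⟨_, (hL.add h2).congr' ?_⟩
  filter_upwards [self_mem_nhdsWithin] with ε hε
  exact (cconv_oscKernel_eq hs b hε hf x).symm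

lemma oscKernel_mul_eq_indicator (Q : ℝ → ℝ) (S : Set ℝ) (f : ℝ → ℂ) (x : ℝ) :
    (fun t => oscKernel Q S t * f (x - t)) = S.indicator (oscIntegrand Q f x) := by
  ext t
  by_cases ht : t ∈ S
  · simp only [oscKernel, oscIntegrand, Set.indicator_of_mem ht]
    ring
  · simp [oscKernel, ht]

lemma truncatedIntegral_oscIntegrand (Q : ℝ → ℝ) (f : ℝ → ℂ) (x ε : ℝ) :
    truncatedIntegral (oscIntegrand Q f x) ε = cconv (oscKernel Q (outerSet ε)) f x := by
  rw [cconv_apply, oscKernel_mul_eq_indicator, integral_indicator (measurableSet_outerSet ε)]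
  rfl

lemma integrableOn_oscIntegrand {Q : ℝ → ℝ} (hQ : Measurable Q) {f : ℝ → ℂ} (hf : MemLp f 2)
    (x : ℝ) {ε : ℝ} (hε : 0 < ε) : IntegrableOn (oscIntegrand Q f x) {t : ℝ | ε < |t|} := by
  have h := integrable_mul_comp_sub_left (memLp_oscKernel_outerSet hQ hε) hf x
  rw [oscKernel_mul_eq_indicator, integrable_indicator_iff (measurableSet_outerSet ε)] at h
  exact h

/-- Collecting equal exponents. -/
lemma exists_fewnomial_eq_monomialSum {d : ℕ} (a : Fin d → ℝ) (α : Fin d → ℕ)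
    (hα : ∀ i, 0 < α i) : ∃ s : Finset ℕ, ∃ b : ℕ → ℝ, 0 ∉ s ∧ s.card ≤ d ∧
      fewnomial a α = monomialSum s b := by
  refine ⟨Finset.univ.image α, fun k => ∑ i with α i = k, a i, ?_, ?_, ?_⟩
  · simp only [Finset.mem_image, not_exists]
    exact fun i hi => (hα i).ne' hi.2
  · simpa using Finset.card_image_le (s := Finset.univ) (f := α)
  · ext t
    rw [fewnomial, monomialSum, ← Finset.sum_fiberwise_of_maps_to (t := Finset.univ.image α)
      (g := α) (fun i hi => Finset.mem_image_of_mem α hi)]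
    refine Finset.sum_congr rfl fun k _ => ?_
    rw [Finset.sum_mul]
    refine Finset.sum_congr rfl fun i hi => ?_
    rw [(Finset.mem_filter.1 hi).2]

lemma phaseBound_mono {m n : ℕ} (h : m ≤ n) : phaseBound m ≤ phaseBound n := by
  have := largeBound_mono h
  unfold phaseBound
  gcongr

/-- For each `d` there is a constant `C`, chosen before the coefficients, the exponents and `f`,
such that for every `f ∈ L²(ℝ)` the principal value `H_Q f(x)` exists for almost every `x`,
`H_Q f ∈ L²(ℝ)`, and `‖H_Q f‖₂ ≤ C ‖f‖₂`. -/
theorem theorem1p1 (d : ℕ) :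
    ∃ C : ℝ≥0, ∀ (a : Fin d → ℝ) (α : Fin d → ℕ), (∀ i, 0 < α i) →
      ∀ f : ℝ → ℂ, MemLp f 2 volume →
        (∀ᵐ x : ℝ, HasPrincipalValue (oscIntegrand (fewnomial a α) f x)
          (oscHilbert (fewnomial a α) f x)) ∧
        MemLp (oscHilbert (fewnomial a α) f) 2 volume ∧
        eLpNorm (oscHilbert (fewnomial a α) f) 2 volume ≤ (C : ℝ≥0∞) * eLpNorm f 2 volume := by
  refine ⟨(phaseBound (d + 1)).toNNReal, fun a α hα f hf => ?_⟩
  obtain ⟨s, b, hs, hcard, hQ⟩ := exists_fewnomial_eq_monomialSum a α hα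
  rw [hQ]
  have hm := (continuous_monomialSum s b).measurable
  have hpv : ∀ᵐ x : ℝ, HasPrincipalValue (oscIntegrand (monomialSum s b) f x)
      (oscHilbert (monomialSum s b) f x) := by
    filter_upwards [ae_exists_tendsto_cconv_oscKernel hs b hf] with x ⟨L, hL⟩
    have h : HasPrincipalValue (oscIntegrand (monomialSum s b) f x) L := by
      refine ⟨fun ε hε => integrableOn_oscIntegrand hm hf x hε, hL.congr fun ε => ?_⟩
      exact (truncatedIntegral_oscIntegrand _ _ _ _).symm
    rw [oscHilbert, h.principalValue_eq]
    exact h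
  have hpos : ∀ n : ℕ, (0 : ℝ) < 1 / (n + 1) := fun n => Nat.one_div_pos_of_nat
  have hmeas : ∀ n : ℕ, AEStronglyMeasurable
      (cconv (oscKernel (monomialSum s b) (outerSet (1 / ((n : ℝ) + 1)))) f) := fun n =>
    aestronglyMeasurable_cconv (memLp_oscKernel_outerSet hm (hpos n)) hf
  have hlim : ∀ᵐ x : ℝ, Tendsto
      (fun n : ℕ => cconv (oscKernel (monomialSum s b) (outerSet (1 / ((n : ℝ) + 1)))) f x) atTop
      (𝓝 (oscHilbert (monomialSum s b) f x)) := by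
    filter_upwards [hpv] with x hx
    have hseq : Tendsto (fun n : ℕ => 1 / ((n : ℝ) + 1)) atTop (𝓝[>] 0) :=
      tendsto_nhdsWithin_iff.2
        ⟨tendsto_one_div_add_atTop_nhds_zero_nat, Eventually.of_forall hpos⟩
    simpa only [Function.comp_def, truncatedIntegral_oscIntegrand] using hx.2.comp hseq
  have hle : eLpNorm (oscHilbert (monomialSum s b) f) 2 volume ≤
      ((phaseBound (d + 1)).toNNReal : ℝ≥0∞) * eLpNorm f 2 volume := by
    refine eLpNorm_le_of_tendsto hmeas hlim (fun n => ?_) tendsto_const_nhds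
    refine (eLpNorm_cconv_outerSet_le hs b (hpos n) hf).trans ?_
    gcongr
    exact phaseBound_mono (by omega)
  exact ⟨hpv, ⟨aestronglyMeasurable_of_tendsto_ae _ hmeas hlim,
    hle.trans_lt (ENNReal.mul_lt_top ENNReal.coe_lt_top hf.eLpNorm_lt_top)⟩, hle⟩
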